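/- Let $(\mathcal A,\varphi,\varphi_2)$ be a second order probability space: $\mathcal A$ is a unital $*$-algebra over $\mathbb C$, $\varphi:\mathcal A\to\mathbb C$ is a linear trace with $\varphi(1)=1$, and $\varphi_2:\mathcal A\times\mathcal A\to\mathbb C$ is bilinear, symmetric, tracial in each variable, with $\varphi_2(1,a)=0$ for all $a$. Let $u\in\mathcal A$ be a second order Haar unitary, i.e. $u$ is unitary, $\varphi(u^k)=\varphi(u^{*k})=0$ for $k\ge1$, and $\varphi_2(u^k,u^{*l})=k\,\delta_{k,l}$ for $k,l\ge 1$. Notation. For a permutation $\pi$ of $N$ points, $|\pi|$ is $N$ minus the number of cycles of $\pi$; $\gamma_n=(1,\dots,n)$ and $\gamma_{m,n}=(1,\dots,m)(m+1,\dots,m+n)$. $NC(n)$ is the set of non-crossing partitions of $\{1,\dots,n\}$, identified with the permutations $\pi$ such that $|\pi|+|\pi^{-1}\gamma_n|=|\gamma_n|$. $S_{NC}(m,n)$ is the set of non-crossing annular permutations: the permutations $\pi$ of $\{1,\dots,m+n\}$ having a cycle that meets both cycles of $\gamma_{m,n}$, with $|\pi|+|\pi^{-1}\gamma_{m,n}|=|\gamma_{m,n}|+2$.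 $\mathcal{PS}_{NC}(m,n)$ consists of the pairs $(0_\pi,\pi)$ with $\pi\in S_{NC}(m,n)$ and $0_\pi$ the partition into cycles of $\pi$, and of the pairs $(\mathcal V,\pi)$ with $\pi=\pi_1\times\pi_2\in NC(m)\times NC(n)$ and $\mathcal V$ obtained from $0_\pi$ by joining one cycle of $\pi_1$ with one cycle of $\pi_2$. Given first order functionals $f_n$ of $n$ arguments and second order functionals $f_{m,n}$ of $m+n$ arguments, $f_\pi$ and $f_{(\mathcal V,\pi)}$ denote the products over the blocks, where a block that is a single cycle $(i_1,\dots,i_l)$ contributes $f_l(a_{i_1},\dots,a_{i_l})$ and a block that joins two cycles $(i_1,\dots,i_k)$, $(j_1,\dots,j_l)$ contributes $f_{k,l}(a_{i_1},\dots,a_{i_k},a_{j_1},\dots,a_{j_l})$. The free cumulants $\kappa_n$ and the second order cumulants $\kappa_{m,n}$ are determined recursively by $$\varphi(a_1\cdots a_n)=\sum_{\pi\in NC(n)}\kappa_\pi(a_1,\dots,a_n),\qquad \varphi_2(a_1\cdots a_m,\,a_{m+1}\cdots a_{m+n})=\sum_{(\mathcal V,\pi)\in\mathcal{PS}_{NC}(m,n)}\kappa_{(\mathcal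 V,\pi)}(a_1,\dots,a_{m+n}).$$ The values $\mu_n$, $\mu_{m,n}$ $(m,n\ge1)$ of the Möbius function (the solution of $\mu*\zeta=\delta$, where $\mu_n$, $\mu_{m,n}$ are the values at $(1_n,\gamma_n)$ and $(1_{m+n},\gamma_{m,n})$) are the integers determined recursively by $$\sum_{\pi\in NC(n)}\mu_\pi=\delta_{n,1},\qquad \sum_{(\mathcal V,\pi)\in\mathcal{PS}_{NC}(m,n)}\mu_{(\mathcal V,\pi)}=0 ,$$ and $c_{m,n}:=|\mu_{m,n}|$. **Proposition.** Let $p=2m$ and $q=2n$ with $m,n\ge1$, and let $\epsilon_1,\dots,\epsilon_{p+q}\in\{-1,1\}$ be alternating on each circle: $\epsilon_{i+1}=-\epsilon_i$ for all $1\le i<p+q$ with $i\ne p$. Then, with $u^{-1}=u^*$, $$\kappa_{p,q}(u^{\epsilon_1},\dots,u^{\epsilon_{p+q}})=(-1)^{m+n}c_{m,n}=\mu_{m,n}.$$ -/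

import Mathlib

namespace SecondOrderFree

open Equiv Finset

/-! ### Non-crossing permutations of a disc and of an annulus -/

/-- The smallest points of the cycles of `π` (fixed points are cycles): one point per cycle. -/
def leaders {N : ℕ} (π : Perm (Fin N)) : Finset (Fin N) :=
  univ.filter fun i => ∀ j, π.SameCycle i j → i ≤ j

/-- `|π| = N - #(π)`, where `#(π)` is the number of cycles of `π`. -/
def permLength {N : ℕ} (π : Perm (Fin N)) : ℕ :=
  N - (leaders π).card

/-- `NC(n)`, each partition being identified with the permutation whose cycles are its blocks in
increasing order: these are the `π` with `|π| + |π⁻¹ γ_n| = |γ_n|`, where `γ_n = (1, …, n)`. -/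
def NC (n : ℕ) : Finset (Perm (Fin n)) :=
  univ.filter fun π => permLength π + permLength (π⁻¹ * finRotate n) = permLength (finRotate n)

/-- `γ_{m,n} = (1, …, m)(m+1, …, m+n)`. -/
def annularRotate (m n : ℕ) : Perm (Fin (m + n)) :=
  finSumFinEquiv.permCongr (Perm.sumCongr (finRotate m) (finRotate n))

/-- `S_NC(m,n)`: the non-crossing annular permutations, i.e. those `π` which have a cycle meeting
both circles and satisfy `|π| + |π⁻¹ γ_{m,n}| = |γ_{m,n}| + 2`. -/
def annularNC (m n : ℕ) : Finset (Perm (Fin (m + n))) :=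
  univ.filter fun π =>
    (∃ (i : Fin m) (j : Fin n), π.SameCycle (Fin.castAdd n i) (Fin.natAdd m j)) ∧
    permLength π + permLength (π⁻¹ * annularRotate m n) = permLength (annularRotate m n) + 2

/-! ### Multiplicative functions and convolution with the zeta function

A function of first order assigns a scalar to each word over an alphabet `α`, a function of second
order to each pair of words. Over a one-letter alphabet these are simple and double sequences. -/

section Convolution

variable {α R : Type*} [CommRing R]

/-- The word `(a_i, a_{π(i)}, a_{π²(i)}, …)` read once along the cycle of `π` through `i`. -/
def cycleWord {N : ℕ} (a : Fin N → α) (π : Perm (Fin N)) (i : Fin N) : List α :=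
  (List.range (univ.filter fun j => π.SameCycle i j).card).map fun k => a ((π ^ k) i)

/-- `F_π(a) = ∏ F(a_{i_1}, …, a_{i_l})`, over the cycles `(i_1, …, i_l)` of `π`. -/
def multExt {N : ℕ} (F : List α → R) (a : Fin N → α) (π : Perm (Fin N)) : R :=
  ∏ i ∈ leaders π, F (cycleWord a π i)

/-- `F_π(a)` without the factor of the cycle with smallest point `i`. -/
def multExtErase {N : ℕ} (F : List α → R) (a : Fin N → α) (π : Perm (Fin N)) (i : Fin N) : R :=
  ∏ k ∈ (leaders π).erase i, F (cycleWord a π k)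

/-- `(F ∗ ζ)(w) = ∑_{π ∈ NC(n)} F_π(w)`, for a word `w` of length `n`. -/
def convZeta₁ (F : List α → R) (w : List α) : R :=
  ∑ π ∈ NC w.length, multExt F w.get π

/-- `(F ∗ ζ)(w, v) = ∑_{(V,π) ∈ PS_NC(m,n)} F_{(V,π)}(w, v)`, for words `w`, `v` of lengths `m`, `n`.
The first sum is over `S_NC(m,n)`. The second is over `PS_NC(m,n)'`, whose elements are the
`π = π₁ × π₂` in `NC(m) × NC(n)` together with a cycle of `π₁` (through `i`) and a cycle of `π₂`
(through `j`) that are joined in `V`; the two joined cycles contribute a second order factor. -/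
def convZeta₂ (F₁ : List α → R) (F₂ : List α → List α → R) (w v : List α) : R :=
  (∑ π ∈ annularNC w.length v.length, multExt F₁ (Fin.append w.get v.get) π) +
  ∑ π₁ ∈ NC w.length, ∑ π₂ ∈ NC v.length, ∑ i ∈ leaders π₁, ∑ j ∈ leaders π₂,
    F₂ (cycleWord w.get π₁ i) (cycleWord v.get π₂ j) *
      (multExtErase F₁ w.get π₁ i * multExtErase F₁ v.get π₂ j)

/-- The function `F` with `F ∗ ζ = M` in first order (see `convZeta₁_unzeta₁`), by recursion on the
length of the word: all cycles of a `π ∈ NC(n)` other than `γ_n` have fewer than `n` points, so the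
value `0` in the `else` branch is never used. -/
def unzeta₁ (M : List α → R) (w : List α) : R :=
  M w - ∑ π ∈ (NC w.length).erase (finRotate w.length), ∏ i ∈ leaders π,
    if _h : (cycleWord w.get π i).length < w.length then unzeta₁ M (cycleWord w.get π i) else 0
termination_by w.length

/-- The function `F₂` with `(F₁, F₂) ∗ ζ = M₂` in second order (see `convZeta₂_unzeta₂`), where `F₁`
is the first order function with `F₁ ∗ ζ = M₁`, by recursion on the total length of the two words.
The `else` branch removes exactly the term of `(1_{m+n}, γ_{m,n})`, which is the value that is being
defined. -/
def unzeta₂ (M₁ : List α → R) (M₂ : List α → List α → R) (w v : List α) : R :=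
  M₂ w v - (∑ π ∈ annularNC w.length v.length,
    multExt (unzeta₁ M₁) (Fin.append w.get v.get) π) -
  ∑ π₁ ∈ NC w.length, ∑ π₂ ∈ NC v.length, ∑ i ∈ leaders π₁, ∑ j ∈ leaders π₂,
    if _h : (cycleWord w.get π₁ i).length + (cycleWord v.get π₂ j).length < w.length + v.length then
      unzeta₂ M₁ M₂ (cycleWord w.get π₁ i) (cycleWord v.get π₂ j) *
        (multExtErase (unzeta₁ M₁) w.get π₁ i * multExtErase (unzeta₁ M₁) v.get π₂ j)
    else 0
termination_by w.length + v.length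

/-! The recursions above do invert the convolution with the zeta function. -/

theorem length_cycleWord {N : ℕ} (a : Fin N → α) (π : Perm (Fin N)) (i : Fin N) :
    (cycleWord a π i).length = (univ.filter fun j => π.SameCycle i j).card := by
  simp [cycleWord]

theorem length_cycleWord_le {N : ℕ} (a : Fin N → α) (π : Perm (Fin N)) (i : Fin N) :
    (cycleWord a π i).length ≤ N := by
  rw [length_cycleWord]
  simpa using Finset.card_le_univ (univ.filter fun j => π.SameCycle i j)

theorem mem_leaders {N : ℕ} {π : Perm (Fin N)} {i : Fin N} :
    i ∈ leaders π ↔ ∀ j, π.SameCycle i j → i ≤ j := by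
  simp [leaders]

/-- Only the identity has length `0`. -/
theorem eq_one_of_permLength {N : ℕ} {π : Perm (Fin N)} (h : permLength π = 0) : π = 1 := by
  have h1 : (leaders π).card = (univ : Finset (Fin N)).card := by
    have := Finset.card_le_univ (leaders π)
    simp [permLength] at h this ⊢
    omega
  have h2 : leaders π = univ := Finset.eq_univ_of_card _ (by simpa using h1)
  ext i
  have hi : i ∈ leaders π := by simp [h2]
  have hj : π i ∈ leaders π := by simp [h2]
  have a := mem_leaders.1 hi (π i) ⟨1, by simp⟩
  have b := mem_leaders.1 hj i ⟨-1, by simp⟩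
  simp [le_antisymm b a]

theorem leaders_of_full {N : ℕ} {π : Perm (Fin (N + 1))} (h : ∀ i j, π.SameCycle i j) :
    leaders π = {0} := by
  ext i
  rw [mem_leaders]
  simp only [Finset.mem_singleton]
  constructor
  · intro hi
    exact le_antisymm (hi 0 (h _ _)) (Fin.zero_le _)
  · rintro rfl j _
    exact Fin.zero_le _

theorem full_of_length {N : ℕ} (a : Fin N → α) (π : Perm (Fin N)) (i : Fin N)
    (h : ¬ (cycleWord a π i).length < N) (k l : Fin N) : π.SameCycle k l := by
  have h1 : (univ.filter fun j => π.SameCycle i j) = univ := by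
    apply Finset.eq_univ_of_card
    have := length_cycleWord_le a π i
    rw [length_cycleWord] at h this
    simp
    omega
  have h2 : ∀ j, π.SameCycle i j := fun j => by
    have : j ∈ (univ.filter fun j => π.SameCycle i j) := by rw [h1]; simp
    simpa using this
  exact (h2 k).symm.trans (h2 l)

theorem finRotate_pow_zero {N : ℕ} (k : ℕ) (hk : k < N + 1) :
    ((finRotate (N + 1)) ^ k) 0 = ⟨k, hk⟩ := by
  induction k with
  | zero => rfl
  | succ k ih =>
    rw [pow_succ', Perm.mul_apply, ih (by omega), finRotate_of_lt (by omega)]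

theorem finRotate_full {N : ℕ} (i j : Fin (N + 1)) : (finRotate (N + 1)).SameCycle i j := by
  have h : ∀ i : Fin (N + 1), (finRotate (N + 1)).SameCycle 0 i := fun i =>
    ⟨(i : ℕ), by rw [zpow_natCast, finRotate_pow_zero _ i.2]⟩
  exact (h i).symm.trans (h j)

/-- A non-crossing permutation with a cycle through all points is `γ_n`. -/
theorem eq_finRotate_of_full {N : ℕ} {π : Perm (Fin (N + 1))} (hπ : π ∈ NC (N + 1))
    (h : ∀ i j, π.SameCycle i j) : π = finRotate (N + 1) := by
  have h1 := leaders_of_full h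
  have h2 := leaders_of_full (finRotate_full (N := N))
  simp only [NC, Finset.mem_filter, permLength, h1, h2] at hπ
  have h3 : permLength (π⁻¹ * finRotate (N + 1)) = 0 := by
    unfold permLength
    simp at hπ
    omega
  exact (inv_mul_eq_one.1 (eq_one_of_permLength h3))

theorem finRotate_mem_NC (n : ℕ) : finRotate n ∈ NC n := by
  have : leaders (1 : Perm (Fin n)) = univ := by
    ext i; simp [mem_leaders]
  rw [NC, Finset.mem_filter]
  refine ⟨Finset.mem_univ _, ?_⟩
  rw [inv_mul_cancel]
  simp [permLength, this]

theorem cycleWord_finRotate {N : ℕ} (a : Fin (N + 1) → α) :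
    cycleWord a (finRotate (N + 1)) 0 = List.ofFn a := by
  apply List.ext_getElem
  · simp [cycleWord, finRotate_full]
  · intro k h1 h2
    simp only [cycleWord, List.getElem_map, List.getElem_range, List.getElem_ofFn]
    rw [finRotate_pow_zero]


theorem convZeta₁_unzeta₁ (M : List α → R) (w : List α) (hw : w ≠ []) :
    convZeta₁ (unzeta₁ M) w = M w := by
  obtain ⟨n, hn⟩ : ∃ n, w.length = n + 1 :=
    Nat.exists_eq_succ_of_ne_zero (by simpa using hw)
  have key : ∀ (n : ℕ) (a : Fin n → α), n ≠ 0 → multExt (unzeta₁ M) a (finRotate n) =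
      unzeta₁ M (List.ofFn a) := by
    intro n a h
    obtain ⟨n, rfl⟩ := Nat.exists_eq_succ_of_ne_zero h
    rw [multExt, leaders_of_full finRotate_full, Finset.prod_singleton, cycleWord_finRotate]
  have small : ∀ (n : ℕ) (a : Fin n → α), n ≠ 0 → ∀ π ∈ (NC n).erase (finRotate n),
      ∀ i, (cycleWord a π i).length < n := by
    intro n a h π hπ i
    obtain ⟨n, rfl⟩ := Nat.exists_eq_succ_of_ne_zero h
    by_contra hlt
    exact Finset.ne_of_mem_erase hπ
      (eq_finRotate_of_full (Finset.mem_of_mem_erase hπ) (full_of_length a π i hlt))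
  have hlen : w.length ≠ 0 := by omega
  rw [convZeta₁, ← Finset.add_sum_erase _ _ (finRotate_mem_NC w.length), key _ _ hlen,
    List.ofFn_get, unzeta₁]
  have : ∑ π ∈ (NC w.length).erase (finRotate w.length), multExt (unzeta₁ M) w.get π =
      ∑ π ∈ (NC w.length).erase (finRotate w.length), ∏ i ∈ leaders π,
        if _h : (cycleWord w.get π i).length < w.length
        then unzeta₁ M (cycleWord w.get π i) else 0 := by
    refine Finset.sum_congr rfl fun π hπ => Finset.prod_congr rfl fun i _ => ?_
    rw [dif_pos (small _ _ hlen π hπ i)]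
  rw [this]
  ring

theorem convZeta₂_unzeta₂ (M₁ : List α → R) (M₂ : List α → List α → R) (w v : List α)
    (hw : w ≠ []) (hv : v ≠ []) : convZeta₂ (unzeta₁ M₁) (unzeta₂ M₁ M₂) w v = M₂ w v := by
  -- the term `t` of `(1_{m+n}, γ_{m,n})` is the only one that the recursion leaves out
  have key : ∀ (m n : ℕ) (a : Fin m → α) (b : Fin n → α), m ≠ 0 → n ≠ 0 →
      ∀ (F : List α → R) (G : List α → List α → R),
      (∑ π₁ ∈ NC m, ∑ π₂ ∈ NC n, ∑ i ∈ leaders π₁, ∑ j ∈ leaders π₂,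
        G (cycleWord a π₁ i) (cycleWord b π₂ j) *
          (multExtErase F a π₁ i * multExtErase F b π₂ j)) =
      (∑ π₁ ∈ NC m, ∑ π₂ ∈ NC n, ∑ i ∈ leaders π₁, ∑ j ∈ leaders π₂,
        if _h : (cycleWord a π₁ i).length + (cycleWord b π₂ j).length < m + n then
          G (cycleWord a π₁ i) (cycleWord b π₂ j) *
            (multExtErase F a π₁ i * multExtErase F b π₂ j)
        else 0) + G (List.ofFn a) (List.ofFn b) := by
    intro m n a b hm hn F G
    obtain ⟨m, rfl⟩ := Nat.exists_eq_succ_of_ne_zero hm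
    obtain ⟨n, rfl⟩ := Nat.exists_eq_succ_of_ne_zero hn
    rw [← sub_eq_iff_eq_add']
    simp only [← Finset.sum_sub_distrib]
    rw [Finset.sum_eq_single_of_mem _ (finRotate_mem_NC _),
      Finset.sum_eq_single_of_mem _ (finRotate_mem_NC _),
      leaders_of_full finRotate_full, leaders_of_full finRotate_full,
      Finset.sum_singleton, Finset.sum_singleton, cycleWord_finRotate, cycleWord_finRotate,
      dif_neg (by simp)]
    · simp [multExtErase, leaders_of_full finRotate_full]
    · intro π₂ h₂ hne
      refine Finset.sum_eq_zero fun i _ => Finset.sum_eq_zero fun j _ => ?_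
      rw [dif_pos, sub_self]
      have h1 := length_cycleWord_le a (finRotate (m + 1)) i
      have h2 : (cycleWord b π₂ j).length < n + 1 := by
        by_contra hlt
        exact hne (eq_finRotate_of_full h₂ (full_of_length b π₂ j hlt))
      simp only [Nat.succ_eq_add_one]
      omega
    · intro π₁ h₁ hne
      refine Finset.sum_eq_zero fun π₂ _ => Finset.sum_eq_zero fun i _ =>
        Finset.sum_eq_zero fun j _ => ?_
      rw [dif_pos, sub_self]
      have h1 := length_cycleWord_le b π₂ j
      have h2 : (cycleWord a π₁ i).length < m + 1 := by
        by_contra hlt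
        exact hne (eq_finRotate_of_full h₁ (full_of_length a π₁ i hlt))
      simp only [Nat.succ_eq_add_one]
      omega
  rw [convZeta₂, key _ _ _ _ (by simpa using hw) (by simpa using hv), List.ofFn_get,
    List.ofFn_get]
  conv_lhs => enter [2, 2]; rw [unzeta₂]
  ring

end Convolution

/-! ### The Möbius function -/

/-- The first order values `δ_n` of the unit of convolution: `δ_1 = 1` and `δ_n = 0` otherwise. -/
def delta₁ (w : List Unit) : ℤ := if w.length = 1 then 1 else 0

/-- `μ(1_{m+n}, γ_{m,n})`, the second order values of the Möbius function, which is the solution of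
`μ ∗ ζ = δ`. The second order values of `δ` are all `0`. -/
def moebius₂ (m n : ℕ) : ℤ :=
  unzeta₂ delta₁ (fun _ _ => 0) (List.replicate m ()) (List.replicate n ())

/-- `c_{m,n} = |μ(1_{m+n}, γ_{m,n})|`. -/
def annularCatalan (m n : ℕ) : ℤ := |moebius₂ m n|

/-! ### Second order probability spaces and their cumulants -/

/-- A second order probability space `(A, φ, φ₂)` on a unital algebra `A` over `ℂ`. -/
structure SecondOrderProbabilitySpace (A : Type*) [Ring A] [Algebra ℂ A] where
  φ : A →ₗ[ℂ] ℂ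
  φ₂ : A →ₗ[ℂ] A →ₗ[ℂ] ℂ
  φ_one : φ 1 = 1
  φ_trace : ∀ a b, φ (a * b) = φ (b * a)
  φ₂_symm : ∀ a b, φ₂ a b = φ₂ b a
  φ₂_trace : ∀ a b c, φ₂ (a * b) c = φ₂ (b * a) c
  φ₂_one : ∀ a, φ₂ 1 a = 0

namespace SecondOrderProbabilitySpace

variable {A : Type*} [Ring A] [Algebra ℂ A] (P : SecondOrderProbabilitySpace A)

/-- The free cumulants `κ_n(a_1, …, a_n)`, as a function of the word `[a_1, …, a_n]`. -/
noncomputable def cumulant₁ (w : List A) : ℂ :=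
  unzeta₁ (fun w => P.φ w.prod) w

/-- The second order cumulants `κ_{m,n}(a_1, …, a_m, b_1, …, b_n)`, as a function of the two words
`[a_1, …, a_m]` and `[b_1, …, b_n]`. -/
noncomputable def cumulant₂ (w v : List A) : ℂ :=
  unzeta₂ (fun w => P.φ w.prod) (fun w v => P.φ₂ w.prod v.prod) w v

/-- The first order moment-cumulant formula `φ(a_1 ⋯ a_n) = ∑_{π ∈ NC(n)} κ_π(a_1, …, a_n)`. -/
theorem moment_cumulant₁ (w : List A) (hw : w ≠ []) :
    P.φ w.prod = convZeta₁ P.cumulant₁ w :=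
  (convZeta₁_unzeta₁ (fun w => P.φ w.prod) w hw).symm

/-- The second order moment-cumulant formula
`φ₂(a_1 ⋯ a_m, b_1 ⋯ b_n) = ∑_{(V,π) ∈ PS_NC(m,n)} κ_{(V,π)}(a_1, …, a_m, b_1, …, b_n)`. -/
theorem moment_cumulant₂ (w v : List A) (hw : w ≠ []) (hv : v ≠ []) :
    P.φ₂ w.prod v.prod = convZeta₂ P.cumulant₁ P.cumulant₂ w v :=
  (convZeta₂_unzeta₂ (fun w => P.φ w.prod) (fun w v => P.φ₂ w.prod v.prod) w v hw hv).symm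

/-- A second order Haar unitary. -/
structure IsHaarUnitary [StarRing A] (u : A) : Prop where
  mem_unitary : u ∈ unitary A
  φ_pow : ∀ k : ℕ, 1 ≤ k → P.φ (u ^ k) = 0
  φ_star_pow : ∀ k : ℕ, 1 ≤ k → P.φ (star u ^ k) = 0
  φ₂_pow : ∀ k l : ℕ, 1 ≤ k → 1 ≤ l → P.φ₂ (u ^ k) (star u ^ l) = if k = l then (k : ℂ) else 0

end SecondOrderProbabilitySpace

/-- `a^{(ε)}`, i.e. `a` if `ε = 1` and `a*` if `ε = -1`. -/
def starLetter {A : Type*} [Star A] (a : A) (ε : ℤˣ) : A := if ε = 1 then a else star a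

end SecondOrderFree

/-! The moment-cumulant formulas determine cumulants recursively, so it suffices to guess them and
to check the guess (`unzeta₁_map_eq`, `unzeta₂_map_eq`). The checks use a cut-and-join recursion.

Call |π| + |π⁻¹γ| - |γ| the defect of `π`. Both convolutions become sums over all permutations
(`sum_NC_eq`, `sum_annular_eq`): discs and pairs of discs have defect 0, annular permutations have
defect 2. Fix a point `x`. Every permutation is uniquely `π * swap i x` with `π x = γ x`. If `i` is
another point of the cycle of `x`, the transposition cuts this cycle and keeps the defect. If `i`
lies in another cycle, it joins the two and raises the defect by 2. Summing over `i` gives `cutSum₁`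
of the cycle of `x`, and in second order also `cutSum₂` of this cycle and a cycle on the other
circle (`sum_weight₁`, `sum_weight₂`).

Möbius function: the signed Catalan numbers have `cutSum₁` equal to 1 on one-letter words and 0
otherwise. The recursion of `annularNumber` says precisely that `cutSum₂` vanishes. Hence μ_{m,n} =
(-1)^{m+n} `annularNumber n m` (`moebius₂_eq_signedAnnular`).

Haar unitary: the candidates vanish off alternating words, and on words of lengths 2m, 2n they take
the Möbius values of the half lengths (`altFun₁`, `altFun₂`). If the neighbours `x`, `γ x` carry
opposite letters, `cutSum₂` vanishes, and `cutSum₁` is 1 when the cycle of `x` is just `(x, γ x)`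
and 0 otherwise. The pair can therefore be deleted (`sum_weight₁_kill`, `sum_weight₂_kill`). A word
of total exponent 0 has such neighbours at a maximum of its partial sums, so induction erases the
word. The sum is then 1 in first order, which is φ(1), and 0 in second order, which is φ₂(1, ·)
(`convZeta₁_altFun₁`, `convZeta₂_altFun₂`).

Words of exponent 0 suffice: in a nonzero term the cycles with a first order factor are balanced,
hence so are the two joined ones (`exponent_cycleWord_eq_zero`). -/

namespace SecondOrderFree
open Equiv Finset

/-! ### Cycles as lists -/

/-- `l` lists the points of a cycle of `π` in cyclic order. -/
def IsCycleList {ι : Type*} (π : Perm ι) (l : List ι) : Prop :=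
  l ≠ [] ∧ l.Nodup ∧ l.map π = l.rotate 1

/-- The cycle of `π` through `i`, as a list that starts with `i`. -/
def cycleList {N : ℕ} (π : Perm (Fin N)) (i : Fin N) : List (Fin N) := cycleWord id π i

theorem cycleWord_eq_map {α : Type*} {N : ℕ} (a : Fin N → α) (π : Perm (Fin N)) (i : Fin N) :
    cycleWord a π i = (cycleList π i).map a := by
  simp [cycleList, cycleWord]

namespace IsCycleList

variable {N : ℕ} {π : Perm (Fin N)} {l : List (Fin N)}

theorem getElem_mod (h : IsCycleList π l) (k : ℕ) (hk : k < l.length) :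
    π l[k] = l[(k + 1) % l.length]'(Nat.mod_lt _ (by omega)) := by
  have h3 := h.2.2
  have : (l.map π)[k]'(by simpa using hk) = (l.rotate 1)[k]'(by simpa using hk) := by
    simp only [h3]
  simpa [List.getElem_rotate] using this

theorem getElem_eq_pow {x : Fin N} (h : IsCycleList π (x :: l)) (k : ℕ) (hk : k < (x :: l).length) :
    (x :: l)[k] = (π ^ k) x := by
  induction k with
  | zero => simp
  | succ k ih =>
    have h1 := h.getElem_mod k (by omega)
    rw [pow_succ', Perm.mul_apply, ← ih (by omega), h1]
    congr 1
    exact (Nat.mod_eq_of_lt hk).symm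

theorem apply_mem (h : IsCycleList π l) {z : Fin N} (hz : z ∈ l) : π z ∈ l := by
  have : π z ∈ l.map π := List.mem_map_of_mem hz
  rw [h.2.2] at this
  simpa using this

theorem mem_iff {x z : Fin N} (h : IsCycleList π l) (hx : x ∈ l) :
    z ∈ l ↔ π.SameCycle x z := by
  constructor
  · have key : ∀ (k : ℕ) (hk : k < l.length), π.SameCycle (l[0]'(by omega)) l[k] := by
      intro k
      induction k with
      | zero => intro hk; exact Perm.SameCycle.refl _ _
      | succ k ih =>
        intro hk
        have h1 := h.getElem_mod k (by omega)
        have h2 := ih (by omega)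
        rw [← Perm.sameCycle_apply_right, h1] at h2
        simpa only [Nat.mod_eq_of_lt hk] using h2
    intro hz
    obtain ⟨k, hk, rfl⟩ := List.getElem_of_mem hz
    obtain ⟨k', hk', rfl⟩ := List.getElem_of_mem hx
    exact (key k' hk').symm.trans (key k hk)
  · intro hs
    obtain ⟨k, -, rfl⟩ := hs.exists_pow_eq'
    induction k with
    | zero => simpa using hx
    | succ k ih =>
      rw [pow_succ', Perm.mul_apply]
      exact h.apply_mem (ih ⟨k, by simp⟩)

/-- Any list found by cutting or joining can thus be recognised as the cycle, once its first point
is known. -/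
theorem cycleList_eq {x : Fin N} (h : IsCycleList π (x :: l)) : cycleList π x = x :: l := by
  have hc : (univ.filter fun j => π.SameCycle x j) = (x :: l).toFinset := by
    ext z
    rw [List.mem_toFinset, h.mem_iff (List.mem_cons_self)]
    simp
  have hcard : (univ.filter fun j => π.SameCycle x j).card = (x :: l).length := by
    rw [hc, List.toFinset_card_of_nodup h.2.1]
  apply List.ext_getElem
  · simp only [cycleList, length_cycleWord, hcard]
  · intro k h1 h2
    rw [h.getElem_eq_pow k h2]
    simp [cycleList, cycleWord]

theorem rotate (h : IsCycleList π l) (k : ℕ) : IsCycleList π (l.rotate k) := by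
  refine ⟨by simpa [List.rotate_eq_nil_iff] using h.1, by simpa using h.2.1, ?_⟩
  rw [List.map_rotate, h.2.2, List.rotate_rotate, List.rotate_rotate, add_comm]

end IsCycleList

section

variable {N : ℕ}

theorem isCycleList_cycleList (π : Perm (Fin N)) (x : Fin N) : IsCycleList π (cycleList π x) := by
  classical
  set p := Function.minimalPeriod π x with hp
  have hpos : 0 < p := Function.minimalPeriod_pos_of_mem_periodicPts
    (π.injective.mem_periodicPts x)
  obtain ⟨q, hq⟩ : ∃ q, p = q + 1 := ⟨p - 1, by omega⟩
  have hper : (π ^ p) x = x := by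
    rw [← Perm.iterate_eq_pow]; exact Function.iterate_minimalPeriod
  have hl : IsCycleList π ((List.range p).map fun k => (π ^ k) x) := by
    refine ⟨by simp; omega, ?_, ?_⟩
    · rw [List.nodup_map_iff_inj_on List.nodup_range]
      intro i hi j hj hij
      simp only [← Perm.iterate_eq_pow] at hij
      exact Function.iterate_injOn_Iio_minimalPeriod (by simpa using hi) (by simpa using hj) hij
    · apply List.ext_getElem
      · simp
      · intro k h1 h2
        simp only [List.length_map, List.length_range] at h1
        simp only [List.getElem_map, List.getElem_range, List.getElem_rotate, List.length_map,
          List.length_range]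
        rw [← Perm.mul_apply, ← pow_succ']
        rcases Nat.lt_or_ge (k + 1) p with h | h
        · rw [Nat.mod_eq_of_lt h]
        · have : k + 1 = p := by omega
          rw [this, Nat.mod_self, hper]; rfl
  have h2 : ((List.range p).map fun k => (π ^ k) x) =
      x :: ((List.range q).map fun k => (π ^ (k + 1)) x) := by
    rw [hq, List.range_succ_eq_map]
    simp [Function.comp_def]
  rw [h2] at hl
  rw [hl.cycleList_eq]
  exact hl

theorem mem_cycleList {π : Perm (Fin N)} {x z : Fin N} :
    z ∈ cycleList π x ↔ π.SameCycle x z := by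
  obtain ⟨y, t, ht⟩ := List.exists_cons_of_ne_nil (isCycleList_cycleList π x).1
  refine (isCycleList_cycleList π x).mem_iff ?_
  simp only [cycleList, cycleWord, id, List.mem_map, List.mem_range]
  exact ⟨0, Finset.card_pos.2 ⟨x, by simp [Perm.SameCycle.refl]⟩, by simp⟩

theorem exists_cycleList_eq_cons (π : Perm (Fin N)) (x : Fin N) :
    ∃ l, cycleList π x = x :: l := by
  have h := isCycleList_cycleList π x
  obtain ⟨k, hk, h1⟩ := List.getElem_of_mem (mem_cycleList.2 (Perm.SameCycle.refl π x))
  have h2 := h.rotate k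
  have h3 : (cycleList π x).rotate k =
      x :: ((cycleList π x).drop (k + 1) ++ (cycleList π x).take k) := by
    rw [List.rotate_eq_drop_append_take hk.le, List.drop_eq_getElem_cons hk, h1]
    rfl
  rw [h3] at h2
  exact ⟨_, h2.cycleList_eq⟩

theorem IsCycleList.exists_rotate {π : Perm (Fin N)} {l : List (Fin N)} (h : IsCycleList π l)
    {x : Fin N} (hx : x ∈ l) : ∃ k, cycleList π x = l.rotate k := by
  obtain ⟨k, hk, h1⟩ := List.getElem_of_mem hx
  have h2 := h.rotate k
  have h3 : l.rotate k = x :: (l.drop (k + 1) ++ l.take k) := by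
    rw [List.rotate_eq_drop_append_take hk.le, List.drop_eq_getElem_cons hk, h1]
    rfl
  exact ⟨k, by rw [h3] at h2 ⊢; exact h2.cycleList_eq⟩

/-! ### Cutting and joining cycles -/

/-- Moving the image of the last point to the front removes the rotation, and cutting a cycle
becomes a splitting of appended lists. -/
theorem isCycleList_concat_iff {π : Perm (Fin N)} {t : List (Fin N)} {i : Fin N} :
    IsCycleList π (t ++ [i]) ↔ (t ++ [i]).Nodup ∧ π i :: t.map π = t ++ [i] := by
  unfold IsCycleList
  rw [and_iff_right (by simp)]
  refine and_congr_right fun _ => ?_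
  cases t with
  | nil => simp
  | cons e t =>
    simp only [List.map_append, List.map_cons, List.map_nil, List.cons_append,
      List.rotate_cons_succ, List.rotate_zero, List.cons.injEq]
    constructor
    · intro h
      have := List.append_inj' (s₁ := π e :: t.map π) (t₁ := [π i]) (s₂ := t ++ [i]) (t₂ := [e])
        (by simpa using h) rfl
      simpa [and_comm] using this
    · rintro ⟨h1, h2⟩
      rw [h1, ← List.cons_append, h2]

theorem isCycleList_cons_iff {π : Perm (Fin N)} {u : List (Fin N)} {x : Fin N} :
    IsCycleList π (x :: u) ↔ (x :: u).Nodup ∧ π x :: u.map π = u ++ [x] := by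
  simp [IsCycleList]

theorem map_mul_swap {π : Perm (Fin N)} {l : List (Fin N)} {i x : Fin N} (hi : i ∉ l)
    (hx : x ∉ l) : l.map (π * swap i x) = l.map π := by
  refine List.map_congr_left fun z hz => ?_
  rw [Perm.mul_apply, swap_apply_of_ne_of_ne]
  · rintro rfl; exact hi hz
  · rintro rfl; exact hx hz

theorem IsCycleList.mul_swap_of_notMem {π : Perm (Fin N)} {l : List (Fin N)} {i x : Fin N}
    (h : IsCycleList π l) (hi : i ∉ l) (hx : x ∉ l) : IsCycleList (π * swap i x) l :=
  ⟨h.1, h.2.1, by rw [map_mul_swap hi hx, h.2.2]⟩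

/-- The transposition exchanges the successors of `x` and `i`: the arc from the old successor of `x`
up to `i` closes up, and so does the rest. -/
theorem IsCycleList.cut {π : Perm (Fin N)} {t u : List (Fin N)} {i x : Fin N}
    (h : IsCycleList π (x :: (t ++ i :: u))) :
    IsCycleList (π * swap i x) (x :: u) ∧ IsCycleList (π * swap i x) (t ++ [i]) := by
  obtain ⟨hn, hm⟩ := isCycleList_cons_iff.1 h
  have hn' := hn
  simp only [List.nodup_cons, List.mem_append, List.mem_cons, not_or, List.nodup_append] at hn'
  obtain ⟨⟨hxt, hxi, hxu⟩, ht, ⟨hiu, hu⟩, hd⟩ := hn'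
  have hit : i ∉ t := fun h => hd i h i (by simp) rfl
  have h2 := List.append_inj (s₁ := π x :: t.map π) (t₁ := π i :: u.map π) (s₂ := t ++ [i])
    (t₂ := u ++ [x]) (by simpa using hm) (by simp)
  rw [isCycleList_cons_iff, isCycleList_concat_iff, map_mul_swap hiu hxu, map_mul_swap hit hxt]
  refine ⟨⟨by simp [hxu, hu], by simpa using h2.2⟩, ?_, by simpa using h2.1⟩
  simp only [List.nodup_append, ht, true_and]
  refine ⟨by simp, ?_⟩
  intro a ha b hb
  simp only [List.mem_singleton] at hb
  rintro rfl
  exact hit (hb ▸ ha)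

/-- With the second cycle written so that it ends in `i`, exchanging the successors inserts it
directly after `x`. -/
theorem IsCycleList.join {π : Perm (Fin N)} {t u : List (Fin N)} {i x : Fin N}
    (hx : IsCycleList π (x :: u)) (hi : IsCycleList π (t ++ [i]))
    (hd : List.Disjoint (x :: u) (t ++ [i])) :
    IsCycleList (π * swap i x) (x :: (t ++ i :: u)) := by
  rw [isCycleList_cons_iff] at hx ⊢
  rw [isCycleList_concat_iff] at hi
  obtain ⟨hxn, hxm⟩ := hx
  obtain ⟨hin, him⟩ := hi
  have hn : (x :: (t ++ i :: u)).Nodup := by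
    have : ((x :: u) ++ (t ++ [i])).Nodup := List.Nodup.append hxn hin hd
    refine (List.Perm.nodup_iff ?_).1 this
    rw [List.cons_append]
    refine List.Perm.cons _ ?_
    refine List.perm_append_comm.trans ?_
    simp
  refine ⟨hn, ?_⟩
  have hn' := hn
  simp only [List.nodup_cons, List.mem_append, List.mem_cons, not_or, List.nodup_append] at hn'
  obtain ⟨⟨hxt, hxi, hxu⟩, ht, ⟨hiu, hu⟩, hd⟩ := hn'
  have hit : i ∉ t := fun h => hd i h i (by simp) rfl
  rw [List.map_append, List.map_cons, map_mul_swap hit hxt, map_mul_swap hiu hxu]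
  simp only [Perm.mul_apply, swap_apply_left, swap_apply_right]
  rw [← List.cons_append, him, hxm]
  simp

end

/-! ### Transversals of the cycles -/

section

variable {N : ℕ}

/-- `T` contains exactly one point of each cycle of `π`. -/
def IsTransversal (π : Perm (Fin N)) (T : Finset (Fin N)) : Prop :=
  (∀ z, ∃ t ∈ T, π.SameCycle t z) ∧ ∀ t ∈ T, ∀ t' ∈ T, π.SameCycle t t' → t = t'

theorem isTransversal_leaders (π : Perm (Fin N)) : IsTransversal π (leaders π) := by
  constructor
  · intro z
    have hne : (univ.filter fun j => π.SameCycle z j).Nonempty := ⟨z, by simp [Perm.SameCycle.refl]⟩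
    have hm := Finset.min'_mem _ hne
    simp only [mem_filter, mem_univ, true_and] at hm
    refine ⟨_, mem_leaders.2 fun j hj => Finset.min'_le _ _ ?_, hm.symm⟩
    simpa using hm.trans hj
  · intro t ht t' ht' h
    exact le_antisymm (mem_leaders.1 ht _ h) (mem_leaders.1 ht' _ h.symm)

/-- Smallest points behave badly under a transposition. Passing between transversals allows `x` and
`i` to represent their own cycles. -/
theorem IsTransversal.exists_map {π : Perm (Fin N)} {T T' : Finset (Fin N)}
    (hT : IsTransversal π T) (hT' : IsTransversal π T') :
    ∃ r : Fin N → Fin N, (∀ z, π.SameCycle z (r z)) ∧ T.image r = T' ∧ Set.InjOn r T := by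
  choose r hr hs using hT'.1
  refine ⟨r, fun z => (hs z).symm, ?_, ?_⟩
  · ext z
    rw [mem_image]
    constructor
    · rintro ⟨t, -, rfl⟩
      exact hr t
    · intro hz
      obtain ⟨t, ht, h⟩ := hT.1 z
      exact ⟨t, ht, hT'.2 _ (hr t) _ hz ((hs t).trans h)⟩
  · intro t ht t' ht' h
    refine hT.2 t ht t' ht' ?_
    have h1 := (hs t).symm
    rw [show r t = r t' from h] at h1
    exact h1.trans (hs t')

theorem IsTransversal.prod_eq {R : Type*} [CommMonoid R] {π : Perm (Fin N)} {T T' : Finset (Fin N)}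
    (hT : IsTransversal π T) (hT' : IsTransversal π T') {f : Fin N → R}
    (hf : ∀ z w, π.SameCycle z w → f z = f w) : ∏ t ∈ T', f t = ∏ t ∈ T, f t := by
  obtain ⟨r, hr, rfl, hi⟩ := hT.exists_map hT'
  rw [Finset.prod_image hi]
  exact Finset.prod_congr rfl fun t _ => (hf _ _ (hr t)).symm

theorem IsTransversal.permLength_eq {π : Perm (Fin N)} {T : Finset (Fin N)}
    (hT : IsTransversal π T) : permLength π = N - T.card := by
  obtain ⟨r, -, h, hi⟩ := hT.exists_map (isTransversal_leaders π)
  rw [permLength, ← h, Finset.card_image_of_injOn hi]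

/-- The sum, over the pairs of cycles on either side (with representatives in `T`), of the second
order factor of the pair times the first order factors of the other cycles. -/
def pairSum {R : Type*} [CommRing R] (s : Fin N → Bool) (f₁ : Fin N → R) (f₂ : Fin N → Fin N → R)
    (T : Finset (Fin N)) : R :=
  ∑ i ∈ T, ∑ j ∈ T, if s i = true ∧ s j = false then f₂ i j * ∏ k ∈ (T.erase i).erase j, f₁ k else 0

theorem image_erase_of_injOn {r : Fin N → Fin N} {T : Finset (Fin N)} (hi : Set.InjOn r T)
    {i : Fin N} (h : i ∈ T) : (T.image r).erase (r i) = (T.erase i).image r := by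
  ext z
  simp only [mem_erase, mem_image]
  constructor
  · rintro ⟨h1, t, ht, rfl⟩
    exact ⟨t, ⟨fun h => h1 (h ▸ rfl), ht⟩, rfl⟩
  · rintro ⟨t, ⟨h1, ht⟩, rfl⟩
    exact ⟨fun h2 => h1 (hi ht h h2), t, ht, rfl⟩

theorem IsTransversal.pairSum_eq {R : Type*} [CommRing R] {π : Perm (Fin N)}
    {T T' : Finset (Fin N)} (hT : IsTransversal π T) (hT' : IsTransversal π T')
    {s : Fin N → Bool} {f₁ : Fin N → R} {f₂ : Fin N → Fin N → R}
    (hs : ∀ z w, π.SameCycle z w → s z = s w)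
    (hf₁ : ∀ z w, π.SameCycle z w → f₁ z = f₁ w)
    (hf₂ : ∀ z w z' w', π.SameCycle z w → π.SameCycle z' w' → f₂ z z' = f₂ w w') :
    pairSum s f₁ f₂ T' = pairSum s f₁ f₂ T := by
  obtain ⟨r, hr, rfl, hi⟩ := hT.exists_map hT'
  unfold pairSum
  rw [Finset.sum_image hi]
  refine Finset.sum_congr rfl fun i hiT => ?_
  rw [Finset.sum_image hi]
  refine Finset.sum_congr rfl fun j hjT => ?_
  rw [← hs _ _ (hr i), ← hs _ _ (hr j), ← hf₂ _ _ _ _ (hr i) (hr j)]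
  refine ite_congr rfl (fun h => ?_) fun _ => rfl
  have hji : j ∈ T.erase i := by
    refine mem_erase.2 ⟨?_, hjT⟩
    rintro rfl
    rw [h.1] at h
    simp at h
  rw [image_erase_of_injOn hi hiT,
    image_erase_of_injOn (hi.mono (by exact_mod_cast Finset.erase_subset _ _)) hji,
    Finset.prod_image (hi.mono (by
      exact_mod_cast (Finset.erase_subset _ _).trans (Finset.erase_subset _ _)))]
  congr 1
  exact Finset.prod_congr rfl fun t _ => (hf₁ _ _ (hr t)).symm

theorem pairSum_congr {R : Type*} [CommRing R] {s : Fin N → Bool} {f₁ g₁ : Fin N → R}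
    {f₂ g₂ : Fin N → Fin N → R} {T : Finset (Fin N)} (h₁ : ∀ i ∈ T, f₁ i = g₁ i)
    (h₂ : ∀ i ∈ T, ∀ j ∈ T, f₂ i j = g₂ i j) : pairSum s f₁ f₂ T = pairSum s g₁ g₂ T := by
  refine Finset.sum_congr rfl fun i hi => Finset.sum_congr rfl fun j hj => ?_
  rw [h₂ i hi j hj, Finset.prod_congr rfl fun k hk =>
    h₁ k (Finset.mem_of_mem_erase (Finset.mem_of_mem_erase hk))]

/-- The cycle of `x` is either a member of the joined pair, necessarily the first because of its
side, or a mere first order factor. -/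
theorem pairSum_insert {R : Type*} [CommRing R] {s : Fin N → Bool} {f₁ : Fin N → R}
    {f₂ : Fin N → Fin N → R} {T : Finset (Fin N)} {x : Fin N} (hx : x ∉ T) (hs : s x = true) :
    pairSum s f₁ f₂ (insert x T) =
      (∑ j ∈ T.filter (fun j => s j = false), f₂ x j * ∏ k ∈ T.erase j, f₁ k) +
        f₁ x * pairSum s f₁ f₂ T := by
  unfold pairSum
  rw [Finset.sum_insert hx, Finset.sum_insert hx, Finset.mul_sum, Finset.sum_filter]
  congr 1
  · rw [if_neg (by simp [hs]), zero_add, Finset.erase_insert hx]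
    simp [hs]
  · refine Finset.sum_congr rfl fun i hi => ?_
    rw [Finset.sum_insert hx, if_neg (by simp [hs]), zero_add, Finset.mul_sum]
    refine Finset.sum_congr rfl fun j hj => ?_
    rw [mul_ite, mul_zero]
    refine ite_congr rfl (fun _ => ?_) fun _ => rfl
    have hxi : x ≠ i := fun h => hx (h ▸ hi)
    have hxj : x ≠ j := fun h => hx (h ▸ hj)
    rw [Finset.erase_insert_of_ne hxi, Finset.erase_insert_of_ne hxj, Finset.prod_insert]
    · ring
    · simp [hx]

/-! ### Multiplication with a transposition -/

variable {π : Perm (Fin N)} {T : Finset (Fin N)} {x i : Fin N}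

theorem exists_cycleList_cut (h : π.SameCycle x i) (hne : i ≠ x) :
    ∃ t u, cycleList π x = x :: (t ++ i :: u) ∧ IsCycleList (π * swap i x) (x :: u) ∧
      IsCycleList (π * swap i x) (t ++ [i]) := by
  obtain ⟨l, hl⟩ := exists_cycleList_eq_cons π x
  have hi : i ∈ x :: l := hl ▸ mem_cycleList.2 h
  obtain ⟨t, u, rfl⟩ := List.append_of_mem (List.mem_of_ne_of_mem hne hi)
  exact ⟨t, u, hl, (hl ▸ isCycleList_cycleList π x).cut⟩

theorem cycleList_mul_swap {z : Fin N} (hx : ¬ π.SameCycle z x) (hi : ¬ π.SameCycle z i) :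
    cycleList (π * swap i x) z = cycleList π z := by
  have h := (isCycleList_cycleList π z).mul_swap_of_notMem (i := i) (x := x)
    (fun h => hi (mem_cycleList.1 h)) (fun h => hx (mem_cycleList.1 h))
  obtain ⟨l, hl⟩ := exists_cycleList_eq_cons π z
  rw [hl] at h ⊢
  exact h.cycleList_eq

theorem sameCycle_mul_swap_iff {z w : Fin N} (hx : ¬ π.SameCycle z x) (hi : ¬ π.SameCycle z i) :
    (π * swap i x).SameCycle z w ↔ π.SameCycle z w := by
  rw [← mem_cycleList, cycleList_mul_swap hx hi, mem_cycleList]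

theorem not_sameCycle_mul_swap (h : π.SameCycle x i) (hne : i ≠ x) :
    ¬ (π * swap i x).SameCycle x i := by
  obtain ⟨t, u, hl, hx, hi⟩ := exists_cycleList_cut h hne
  rw [← hx.mem_iff List.mem_cons_self]
  have := (isCycleList_cycleList π x).2.1
  rw [hl] at this
  simp only [List.nodup_cons, List.nodup_append, List.mem_cons, not_or] at this ⊢
  exact ⟨hne, this.2.2.1.1⟩

theorem sameCycle_mul_swap_of_not (h : ¬ π.SameCycle x i) : (π * swap i x).SameCycle x i := by
  obtain ⟨u, hu⟩ := exists_cycleList_eq_cons π x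
  obtain ⟨v, hv⟩ := exists_cycleList_eq_cons π i
  have h1 := isCycleList_cycleList π x
  have h2 := isCycleList_cycleList π i
  have h3 : List.Disjoint (cycleList π x) (cycleList π i) := by
    intro z hz hz'
    exact h ((mem_cycleList.1 hz).trans (mem_cycleList.1 hz').symm)
  have h4 := h2.rotate 1
  rw [hv] at h2 h4 h3
  rw [hu] at h1 h3
  simp only [List.rotate_cons_succ, List.rotate_zero] at h4
  have h5 := h1.join h4 (fun z hz hz' => h3 hz (by simpa [or_comm] using hz'))
  rw [← h5.mem_iff List.mem_cons_self]
  simp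

theorem IsTransversal.notMem_of_sameCycle (hT : IsTransversal π (insert x T)) (hx : x ∉ T)
    (h : π.SameCycle x i) : i ∉ T := by
  intro hi
  have := hT.2 x (by simp) i (by simp [hi]) h
  exact hx (this ▸ hi)

/-- The piece that is cut off contains `i`, the remainder contains `x`, and the other cycles do not
change. -/
theorem IsTransversal.cut (hT : IsTransversal π (insert x T)) (hx : x ∉ T)
    (h : π.SameCycle x i) (hne : i ≠ x) :
    IsTransversal (π * swap i x) (insert x (insert i T)) := by
  obtain ⟨t, u, hl, hcx, hci⟩ := exists_cycleList_cut h hne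
  have hout : ∀ z ∈ T, ¬ π.SameCycle z x ∧ ¬ π.SameCycle z i := fun z hz =>
    ⟨fun hc => hT.notMem_of_sameCycle hx hc.symm hz,
      fun hc => hT.notMem_of_sameCycle hx (h.trans hc.symm) hz⟩
  have hn := not_sameCycle_mul_swap h hne
  constructor
  · intro z
    by_cases hz : π.SameCycle x z
    · have hz' : z ∈ x :: (t ++ i :: u) := hl ▸ mem_cycleList.2 hz
      have : z ∈ x :: u ∨ z ∈ t ++ [i] := by
        simp only [List.mem_cons, List.mem_append, List.not_mem_nil, or_false] at hz' ⊢; tauto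
      rcases this with h1 | h1
      · exact ⟨x, by simp, (hcx.mem_iff List.mem_cons_self).1 h1⟩
      · exact ⟨i, by simp, (hci.mem_iff (by simp)).1 h1⟩
    · obtain ⟨w, hw, hwz⟩ := hT.1 z
      rcases Finset.mem_insert.1 hw with rfl | hw
      · exact absurd hwz hz
      · exact ⟨w, by simp [hw], (sameCycle_mul_swap_iff (hout w hw).1 (hout w hw).2).2 hwz⟩
  · have key : ∀ w ∈ T, ∀ w' ∈ insert x (insert i T), (π * swap i x).SameCycle w w' → w = w' := by
      intro w hw w' hw' hs
      rw [sameCycle_mul_swap_iff (hout w hw).1 (hout w hw).2] at hs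
      simp only [Finset.mem_insert] at hw'
      rcases hw' with rfl | rfl | hw'
      · exact absurd hs (hout w hw).1
      · exact absurd hs (hout w hw).2
      · exact hT.2 w (by simp [hw]) w' (by simp [hw']) hs
    intro w hw w' hw' hs
    by_cases h1 : w ∈ T
    · exact key w h1 w' hw' hs
    by_cases h2 : w' ∈ T
    · exact (key w' h2 w hw hs.symm).symm
    simp only [Finset.mem_insert, h1, h2, or_false] at hw hw'
    rcases hw with rfl | rfl <;> rcases hw' with rfl | rfl
    · rfl
    · exact absurd hs hn
    · exact absurd hs.symm hn
    · rfl

/-- The representatives, other than `x`, of the cycles that do not contain `x`. -/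
def otherLeaders (π : Perm (Fin N)) (x : Fin N) : Finset (Fin N) :=
  (leaders π).filter fun i => ¬ π.SameCycle x i

theorem notMem_otherLeaders (π : Perm (Fin N)) (x : Fin N) : x ∉ otherLeaders π x := by
  simp [otherLeaders, Perm.SameCycle.refl]

theorem not_sameCycle_of_mem_otherLeaders {z : Fin N} (h : z ∈ otherLeaders π x) :
    ¬ π.SameCycle x z := (Finset.mem_filter.1 h).2

theorem isTransversal_otherLeaders (π : Perm (Fin N)) (x : Fin N) :
    IsTransversal π (insert x (otherLeaders π x)) := by
  constructor
  · intro z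
    by_cases h : π.SameCycle x z
    · exact ⟨x, by simp, h⟩
    · obtain ⟨w, hw, hwz⟩ := (isTransversal_leaders π).1 z
      refine ⟨w, Finset.mem_insert_of_mem (Finset.mem_filter.2 ⟨hw, fun h' => h (h'.trans hwz)⟩), hwz⟩
  · intro w hw w' hw' hs
    rcases Finset.mem_insert.1 hw with rfl | h1 <;> rcases Finset.mem_insert.1 hw' with rfl | h2
    · rfl
    · exact absurd hs (not_sameCycle_of_mem_otherLeaders h2)
    · exact absurd hs.symm (not_sameCycle_of_mem_otherLeaders h1)
    · exact (isTransversal_leaders π).2 _ (Finset.mem_filter.1 h1).1 _ (Finset.mem_filter.1 h2).1 hs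

theorem permLength_mul_swap_of_sameCycle (h : π.SameCycle x i) (hne : i ≠ x) :
    permLength (π * swap i x) + 1 = permLength π := by
  have hT := isTransversal_otherLeaders π x
  have hx := notMem_otherLeaders π x
  have hi : i ∉ otherLeaders π x := hT.notMem_of_sameCycle hx h
  have hc := hT.cut hx h hne
  rw [hT.permLength_eq, hc.permLength_eq]
  have h1 := Finset.card_le_univ (insert x (insert i (otherLeaders π x)))
  rw [Finset.card_insert_of_notMem (by simp [hx, hne.symm]), Finset.card_insert_of_notMem hi] at h1 ⊢
  rw [Finset.card_insert_of_notMem hx]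
  simp only [Fintype.card_fin] at h1
  omega

/-- A second multiplication by the transposition undoes the join, so this is the formula for a cut
read backwards. -/
theorem permLength_mul_swap_of_not_sameCycle (h : ¬ π.SameCycle x i) :
    permLength (π * swap i x) = permLength π + 1 := by
  have hne : i ≠ x := by rintro rfl; exact h (Perm.SameCycle.refl _ _)
  have := permLength_mul_swap_of_sameCycle (sameCycle_mul_swap_of_not h) hne
  rw [mul_assoc, swap_mul_self, mul_one] at this
  omega

theorem permLength_mul_swap_le (π : Perm (Fin N)) (x i : Fin N) :
    permLength (π * swap i x) ≤ permLength π + 1 := by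
  by_cases h : π.SameCycle x i
  · rcases eq_or_ne i x with rfl | hne
    · rw [swap_self]
      exact Nat.le_succ _
    · have := permLength_mul_swap_of_sameCycle h hne
      omega
  · exact (permLength_mul_swap_of_not_sameCycle h).le

theorem permLength_one : permLength (1 : Perm (Fin N)) = 0 := by
  have : leaders (1 : Perm (Fin N)) = univ := by
    ext i; simp [mem_leaders]
  simp [permLength, this]

/-- The triangle inequality, with the additional information that in the case of equality `π`
preserves everything that is preserved by the product. -/
theorem permLength_mul_le_and (π σ : Perm (Fin N)) :
    permLength (π * σ) ≤ permLength π + permLength σ ∧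
    (permLength (π * σ) = permLength π + permLength σ →
      ∀ s : Fin N → Bool, (∀ z, s ((π * σ) z) = s z) → ∀ z, s (π z) = s z) := by
  induction hn : permLength σ generalizing σ with
  | zero =>
    obtain rfl := eq_one_of_permLength hn
    simp
  | succ n ih =>
    -- Split off from `σ` the transposition of `x` and `σ x`. It cuts a cycle, so the length drops
    -- by exactly one.
    obtain ⟨x, hx⟩ : ∃ x, σ x ≠ x := by
      by_contra! h
      obtain rfl : σ = 1 := Perm.ext h
      rw [permLength_one] at hn
      omega
    have hs : σ.SameCycle x (σ x) := ⟨1, by simp⟩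
    have h1 := permLength_mul_swap_of_sameCycle hs hx
    obtain ⟨h2, h3⟩ := ih (σ * swap (σ x) x) (by omega)
    rw [← mul_assoc] at h2 h3
    have h4 := permLength_mul_swap_le (π * σ * swap (σ x) x) x (σ x)
    rw [mul_assoc _ (swap _ _), swap_mul_self, mul_one] at h4
    refine ⟨by omega, fun heq s hsγ => h3 (by omega) s ?_⟩
    -- Equality forces the transposition to cut a cycle of the product as well. On that cycle `s` is
    -- constant, so the shorter product still preserves `s`.
    have h5 : (π * σ).SameCycle x (σ x) := by
      by_contra h
      have := permLength_mul_swap_of_not_sameCycle h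
      omega
    have h6 : s x = s (σ x) := by
      obtain ⟨k, -, hk⟩ := h5.exists_pow_eq'
      rw [← hk]
      clear hk
      induction k with
      | zero => rfl
      | succ k ih => rw [pow_succ', Perm.mul_apply (π * σ), hsγ, ih]
    intro z
    rw [Perm.mul_apply (π * σ), hsγ]
    rcases eq_or_ne z x with rfl | h7
    · rw [swap_apply_right, h6]
    rcases eq_or_ne z (σ x) with rfl | h8
    · rw [swap_apply_left, h6]
    · rw [swap_apply_of_ne_of_ne h8 h7]

theorem permLength_mul_le (π σ : Perm (Fin N)) :
    permLength (π * σ) ≤ permLength π + permLength σ := (permLength_mul_le_and π σ).1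

theorem permLength_le_add (γ π : Perm (Fin N)) :
    permLength γ ≤ permLength π + permLength (π⁻¹ * γ) := by
  simpa using permLength_mul_le π (π⁻¹ * γ)

/-- With `s` the side of the annulus: a permutation that connects the two circles never has defect
0. -/
theorem apply_eq_of_geodesic {γ : Perm (Fin N)} {s : Fin N → Bool} (hs : ∀ z, s (γ z) = s z)
    (h : permLength π + permLength (π⁻¹ * γ) = permLength γ) (z : Fin N) : s (π z) = s z :=
  (permLength_mul_le_and π (π⁻¹ * γ)).2 (by simpa using h.symm) s (by simpa using hs) z

end

/-! ### The cut-and-join recursion -/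

section

variable {α R : Type*} [CommRing R] {N : ℕ}

/-- A function of words that depends only on the cyclic word. -/
def IsCyclic {S : Type*} (F : List α → S) : Prop := ∀ l k, F (l.rotate k) = F l

/-- The value of `F` at the cyclic word `b :: l`, plus the values at all its cuts into a word that
starts with `b` and a remaining word. -/
def cutSum₁ (F : List α → R) (b : α) (l : List α) : R :=
  F (b :: l) + ∑ k ∈ range l.length, F (b :: l.drop (k + 1)) * F (l.take (k + 1))

/-- The second order analogue of `cutSum₁`: the cyclic word `b :: l` is cut, or joined with `v`. -/
def cutSum₂ (F₁ : List α → R) (F₂ : List α → List α → R) (b : α) (l v : List α) : R :=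
  F₂ (b :: l) v + (∑ k ∈ range l.length, (F₂ (b :: l.drop (k + 1)) v * F₁ (l.take (k + 1)) +
    F₁ (b :: l.drop (k + 1)) * F₂ (l.take (k + 1)) v)) +
    ∑ k ∈ range v.length, F₁ (b :: (v.rotate (k + 1) ++ l))

/-- The term of `π` in the first order convolution with the zeta function. -/
def weight₁ (F : List α → R) (a : Fin N → α) (γ π : Perm (Fin N)) : R :=
  if permLength π + permLength (π⁻¹ * γ) = permLength γ then multExt F a π else 0

/-- The sum over all pairs of cycles of `π` on either side that may be joined. -/
def pairExt (s : Fin N → Bool) (F₁ : List α → R) (F₂ : List α → List α → R) (a : Fin N → α)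
    (π : Perm (Fin N)) : R :=
  pairSum s (fun i => F₁ (cycleWord a π i)) (fun i j => F₂ (cycleWord a π i) (cycleWord a π j))
    (leaders π)

open Classical in
/-- The terms of `π` in the second order convolution with the zeta function. -/
noncomputable def weight₂ (s : Fin N → Bool) (F₁ : List α → R) (F₂ : List α → List α → R)
    (a : Fin N → α) (γ π : Perm (Fin N)) : R :=
  if ∀ z, s (π z) = s z then
    if permLength π + permLength (π⁻¹ * γ) = permLength γ then pairExt s F₁ F₂ a π else 0
  else
    if permLength π + permLength (π⁻¹ * γ) = permLength γ + 2 then multExt F₁ a π else 0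

theorem IsCyclic.cycleWord_eq {S : Type*} {F : List α → S} (hF : IsCyclic F) (a : Fin N → α)
    {π : Perm (Fin N)} {z w : Fin N} (h : π.SameCycle z w) :
    F (cycleWord a π z) = F (cycleWord a π w) := by
  obtain ⟨k, hk⟩ := (isCycleList_cycleList π z).exists_rotate (mem_cycleList.2 h)
  rw [cycleWord_eq_map, cycleWord_eq_map, hk, List.map_rotate, hF]

theorem IsCyclic.cycleWord_eq_of_isCycleList {S : Type*} {F : List α → S} (hF : IsCyclic F) (a : Fin N → α)
    {π : Perm (Fin N)} {l : List (Fin N)} (hl : IsCycleList π l) {z : Fin N} (h : z ∈ l) :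
    F (cycleWord a π z) = F (l.map a) := by
  obtain ⟨k, hk⟩ := hl.exists_rotate h
  rw [cycleWord_eq_map, hk, List.map_rotate, hF]

theorem side_eq_of_sameCycle {s : Fin N → Bool} {π : Perm (Fin N)} (hs : ∀ z, s (π z) = s z)
    {z w : Fin N} (h : π.SameCycle z w) : s z = s w := by
  obtain ⟨k, -, rfl⟩ := h.exists_pow_eq'
  induction k with
  | zero => rfl
  | succ k ih => rw [pow_succ', Perm.mul_apply, hs, ← ih ⟨k, by simp⟩]

/-- A cyclic function sees only the cycle and not its starting point, so any representatives will
do. -/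
theorem multExt_eq_prod {F : List α → R} (hF : IsCyclic F) (a : Fin N → α) {π : Perm (Fin N)}
    {T : Finset (Fin N)} (hT : IsTransversal π T) :
    multExt F a π = ∏ t ∈ T, F (cycleWord a π t) :=
  hT.prod_eq (isTransversal_leaders π) fun _ _ h => hF.cycleWord_eq a h

theorem pairExt_eq_pairSum {s : Fin N → Bool} {F₁ : List α → R} {F₂ : List α → List α → R}
    (hF₁ : IsCyclic F₁) (hF₂ : ∀ v, IsCyclic (F₂ · v)) (hF₂' : ∀ w, IsCyclic (F₂ w))
    (a : Fin N → α) {π : Perm (Fin N)} (hs : ∀ z, s (π z) = s z)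
    {T : Finset (Fin N)} (hT : IsTransversal π T) :
    pairExt s F₁ F₂ a π = pairSum s (fun i => F₁ (cycleWord a π i))
      (fun i j => F₂ (cycleWord a π i) (cycleWord a π j)) T := by
  refine hT.pairSum_eq (isTransversal_leaders π) (fun _ _ h => side_eq_of_sameCycle hs h)
    (fun _ _ h => hF₁.cycleWord_eq a h) fun z w z' w' h h' => ?_
  rw [(hF₂' _).cycleWord_eq a h']
  exact (hF₂ _).cycleWord_eq a h

theorem sum_sameCycle (g : Fin N → R) {π : Perm (Fin N)} {x : Fin N} {l : List (Fin N)}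
    (hl : cycleList π x = x :: l) :
    ∑ i with π.SameCycle x i, g i = g x + ∑ k : Fin l.length, g l[k] := by
  have hn := (isCycleList_cycleList π x).2.1
  rw [hl] at hn
  have h1 : (univ.filter fun i => π.SameCycle x i) = (x :: l).toFinset := by
    ext z
    rw [List.mem_toFinset, ← hl, mem_cycleList]
    simp
  rw [h1, List.sum_toFinset _ hn, List.map_cons, List.sum_cons]
  congr 1
  rw [← List.sum_ofFn]
  congr 1
  apply List.ext_getElem <;> simp

theorem cycleWord_eq_cons (a : Fin N → α) (π : Perm (Fin N)) (x : Fin N) :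
    cycleWord a π x = a x :: (cycleWord a π x).tail := by
  obtain ⟨l, hl⟩ := exists_cycleList_eq_cons π x
  simp [cycleWord_eq_map, hl]

/-- The remainder is read from `x` and is known as a word. The piece cut off is read from its last
point and is known only up to rotation, hence the `F` around it. -/
theorem cycleWord_cut {S : Type*} {F : List α → S} (hF : IsCyclic F) (a : Fin N → α) {π : Perm (Fin N)}
    {x : Fin N} {l : List (Fin N)} (hl : cycleList π x = x :: l) (k : Fin l.length) :
    π.SameCycle x l[k] ∧ l[k] ≠ x ∧
    cycleWord a (π * swap l[k] x) x = a x :: (l.map a).drop (k + 1) ∧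
    F (cycleWord a (π * swap l[k] x) l[k]) = F ((l.map a).take (k + 1)) := by
  have h := isCycleList_cycleList π x
  rw [hl] at h
  have hdec : l = l.take k ++ l[k] :: l.drop (k + 1) := by simp
  have hne : l[k] ≠ x := fun h' => by
    have := h.2.1
    rw [List.nodup_cons] at this
    exact this.1 (h' ▸ List.getElem_mem _)
  have h' := h
  rw [hdec] at h'
  obtain ⟨h1, h2⟩ := h'.cut
  refine ⟨mem_cycleList.1 (hl ▸ by simp), hne, ?_, ?_⟩
  · rw [cycleWord_eq_map, h1.cycleList_eq, List.map_cons, List.map_drop]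
  · rw [hF.cycleWord_eq_of_isCycleList a h2 (List.mem_append_right _ (List.mem_singleton.2 rfl)), ← List.map_take]
    congr 2
    exact List.take_concat_get' l k k.2

theorem mul_swap_self' (π : Perm (Fin N)) (x : Fin N) : π * swap x x = π := by
  rw [swap_self]; rfl

/-- The summand `i = x` is `π` itself and gives the uncut term of `cutSum₁`; each other point of the
cycle gives one cut. -/
theorem sum_multExt_cut {F : List α → R} (hF : IsCyclic F) (a : Fin N → α) (π : Perm (Fin N))
    (x : Fin N) :
    ∑ i with π.SameCycle x i, multExt F a (π * swap i x) =
      cutSum₁ F (a x) (cycleWord a π x).tail *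
        ∏ t ∈ otherLeaders π x, F (cycleWord a π t) := by
  obtain ⟨l, hl⟩ := exists_cycleList_eq_cons π x
  have hT := isTransversal_otherLeaders π x
  have hx := notMem_otherLeaders π x
  have hw : cycleWord a π x = a x :: l.map a := by rw [cycleWord_eq_map, hl, List.map_cons]
  rw [sum_sameCycle _ hl, mul_swap_self', multExt_eq_prod hF a hT, Finset.prod_insert hx, hw,
    List.tail_cons, cutSum₁, add_mul, Finset.sum_mul, List.length_map,
    Finset.sum_range]
  congr 1
  refine Finset.sum_congr rfl fun k _ => ?_
  obtain ⟨h1, h2, h3, h4⟩ := cycleWord_cut hF a hl k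
  have hk := hT.notMem_of_sameCycle hx h1
  rw [multExt_eq_prod hF a (hT.cut hx h1 h2), Finset.prod_insert fun h => (Finset.mem_insert.1 h).elim (fun h => h2 h.symm) hx,
    Finset.prod_insert hk, h3, h4, mul_assoc]
  congr 2
  refine Finset.prod_congr rfl fun t ht => ?_
  have h5 := not_sameCycle_of_mem_otherLeaders ht
  rw [cycleWord_eq_map, cycleWord_eq_map, cycleList_mul_swap (fun h => h5 h.symm)
    (fun h => h5 (h1.trans h.symm))]

theorem mul_swap_side {s : Fin N → Bool} {π : Perm (Fin N)} {i x : Fin N} (h : s i = s x) :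
    (∀ z, s ((π * swap i x) z) = s z) ↔ ∀ z, s (π z) = s z := by
  have h1 : ∀ z, s (swap i x z) = s z := by
    intro z
    rw [swap_apply_def]
    split_ifs with h1 h2
    · rw [h1, h]
    · rw [h2, h]
    · rfl
  constructor
  · intro h2 z
    have := h2 (swap i x z)
    rwa [Perm.mul_apply, swap_apply_self, h1] at this
  · intro h2 z
    rw [Perm.mul_apply, h2, h1]

/-- Sorted by the role of the cycle of `x`. If it or one of its pieces is joined with a cycle `j` of
the other side, either piece may carry the second order factor. Otherwise all cuts factor out as
`cutSum₁`. -/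
theorem sum_pairExt_cut {s : Fin N → Bool} {F₁ : List α → R} {F₂ : List α → List α → R}
    (hF₁ : IsCyclic F₁) (hF₂ : ∀ v, IsCyclic (F₂ · v)) (hF₂' : ∀ w, IsCyclic (F₂ w))
    (a : Fin N → α) {π : Perm (Fin N)} (hs : ∀ z, s (π z) = s z) {x : Fin N} (hsx : s x = true) :
    ∑ i with π.SameCycle x i, pairExt s F₁ F₂ a (π * swap i x) =
      (∑ j ∈ (otherLeaders π x).filter (fun j => s j = false),
        (F₂ (cycleWord a π x) (cycleWord a π j) +
          ∑ k ∈ range (cycleWord a π x).tail.length,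
            (F₂ (a x :: (cycleWord a π x).tail.drop (k + 1)) (cycleWord a π j) *
              F₁ ((cycleWord a π x).tail.take (k + 1)) +
            F₁ (a x :: (cycleWord a π x).tail.drop (k + 1)) *
              F₂ ((cycleWord a π x).tail.take (k + 1)) (cycleWord a π j))) *
          ∏ t ∈ (otherLeaders π x).erase j, F₁ (cycleWord a π t)) +
      cutSum₁ F₁ (a x) (cycleWord a π x).tail *
        pairSum s (fun i => F₁ (cycleWord a π i))
          (fun i j => F₂ (cycleWord a π i) (cycleWord a π j)) (otherLeaders π x) := by
  obtain ⟨l, hl⟩ := exists_cycleList_eq_cons π x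
  have hT := isTransversal_otherLeaders π x
  have hx := notMem_otherLeaders π x
  have hw : cycleWord a π x = a x :: l.map a := by rw [cycleWord_eq_map, hl, List.map_cons]
  have key : ∀ k : Fin l.length, pairExt s F₁ F₂ a (π * swap l[k] x) =
      (∑ j ∈ (otherLeaders π x).filter (fun j => s j = false),
        (F₂ (a x :: (l.map a).drop (k + 1)) (cycleWord a π j) * F₁ ((l.map a).take (k + 1)) +
        F₁ (a x :: (l.map a).drop (k + 1)) * F₂ ((l.map a).take (k + 1)) (cycleWord a π j)) *
          ∏ t ∈ (otherLeaders π x).erase j, F₁ (cycleWord a π t)) +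
      F₁ (a x :: (l.map a).drop (k + 1)) * F₁ ((l.map a).take (k + 1)) *
        pairSum s (fun i => F₁ (cycleWord a π i))
          (fun i j => F₂ (cycleWord a π i) (cycleWord a π j)) (otherLeaders π x) := by
    intro k
    obtain ⟨h1, h2, h3, h4⟩ := cycleWord_cut hF₁ a hl k
    have h4' := fun v => (cycleWord_cut (hF₂ v) a hl k).2.2.2
    have hk := hT.notMem_of_sameCycle hx h1
    have hsk : s l[k] = s x := (side_eq_of_sameCycle hs h1).symm
    have hout : ∀ t ∈ otherLeaders π x, cycleWord a (π * swap l[k] x) t = cycleWord a π t := by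
      intro t ht
      have h5 := not_sameCycle_of_mem_otherLeaders ht
      rw [cycleWord_eq_map, cycleWord_eq_map, cycleList_mul_swap (fun h => h5 h.symm)
        (fun h => h5 (h1.trans h.symm))]
    rw [pairExt_eq_pairSum hF₁ hF₂ hF₂' a ((mul_swap_side hsk).2 hs) (hT.cut hx h1 h2),
      pairSum_insert (fun h => (Finset.mem_insert.1 h).elim (fun h => h2 h.symm) hx) hsx, pairSum_insert hk (hsk.trans hsx),
      pairSum_congr (fun i hi => by rw [hout i hi])
        (fun i hi j hj => by rw [hout i hi, hout j hj]),
      Finset.filter_insert, if_neg (by rw [hsk, hsx]; simp), mul_add, ← add_assoc,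
      Finset.mul_sum, ← Finset.sum_add_distrib, h3, h4, mul_assoc]
    congr 1
    refine Finset.sum_congr rfl fun j hj => ?_
    have hjT := (Finset.mem_filter.1 hj).1
    have hkj : l[k] ≠ j := fun h => hk (h ▸ hjT)
    rw [Finset.erase_insert_of_ne hkj, Finset.prod_insert fun h => hk (Finset.mem_of_mem_erase h), h4,
      hout j hjT, h4', Finset.prod_congr rfl fun t ht => by
        rw [hout t (Finset.mem_of_mem_erase ht)]]
    ring
  rw [sum_sameCycle _ hl, mul_swap_self', pairExt_eq_pairSum hF₁ hF₂ hF₂' a hs hT,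
    pairSum_insert hx hsx, Finset.sum_congr rfl fun k _ => key k, Finset.sum_add_distrib,
    ← Finset.sum_mul, Finset.sum_comm, hw, List.tail_cons, cutSum₁, List.length_map]
  simp only [Finset.sum_range, add_mul, Finset.sum_add_distrib, ← Finset.sum_mul]
  ring

theorem sum_eq_sum_transversal {π : Perm (Fin N)} {T : Finset (Fin N)} (hT : IsTransversal π T)
    (g : Fin N → R) : ∑ i, g i = ∑ j ∈ T, ∑ i with π.SameCycle j i, g i := by
  rw [← Finset.sum_biUnion]
  · refine Finset.sum_congr ?_ fun _ _ => rfl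
    ext z
    obtain ⟨t, ht, h⟩ := hT.1 z
    simp only [mem_univ, mem_biUnion, mem_filter, true_and, true_iff]
    exact ⟨t, ht, h⟩
  · intro t ht t' ht' hne
    refine Finset.disjoint_left.2 fun z hz hz' => hne (hT.2 t ht t' ht' ?_)
    exact (Finset.mem_filter.1 hz).2.trans (Finset.mem_filter.1 hz').2.symm

/-- The position of `i` in the cycle of `j` determines the rotation in which this cycle is inserted
after `x`. -/
theorem sum_multExt_join {F : List α → R} (hF : IsCyclic F) (a : Fin N → α) {π : Perm (Fin N)}
    {x j : Fin N} (hj : j ∈ otherLeaders π x) :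
    ∑ i with π.SameCycle j i, multExt F a (π * swap i x) =
      (∑ k ∈ range (cycleWord a π j).length,
        F (a x :: ((cycleWord a π j).rotate (k + 1) ++ (cycleWord a π x).tail))) *
        ∏ t ∈ (otherLeaders π x).erase j, F (cycleWord a π t) := by
  obtain ⟨l, hl⟩ := exists_cycleList_eq_cons π x
  obtain ⟨v, hv⟩ := exists_cycleList_eq_cons π j
  have hT := isTransversal_otherLeaders π x
  have hx := notMem_otherLeaders π x
  have hxl := isCycleList_cycleList π x
  have hjl := isCycleList_cycleList π j
  have hxj := not_sameCycle_of_mem_otherLeaders hj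
  set V := cycleList π j with hV
  have h1 : (univ.filter fun i => π.SameCycle j i) = V.toFinset := by
    ext z
    rw [List.mem_toFinset, hV, mem_cycleList]
    simp
  rw [h1, List.sum_toFinset _ hjl.2.1, cycleWord_eq_map, cycleWord_eq_map, hl, List.map_cons,
    List.tail_cons, ← hV, List.length_map, Finset.sum_range, Finset.sum_mul, ← List.sum_ofFn]
  congr 1
  apply List.ext_getElem
  · simp
  intro k hk _
  rw [List.length_map] at hk
  simp only [List.getElem_map, List.getElem_ofFn]
  -- Rotation by `k + 1`, not `k`, puts `V[k]` at the end, as `IsCycleList.join` requires.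
  have hdec : V.rotate (k + 1) = (V.drop (k + 1) ++ V.take k) ++ [V[k]] := by
    rw [List.rotate_eq_drop_append_take (by omega), List.append_assoc, List.take_concat_get']
  set i := V[k] with hi
  have hji : π.SameCycle j i := mem_cycleList.1 (List.getElem_mem _)
  have hxi : ¬ π.SameCycle x i := fun h => hxj (h.trans hji.symm)
  have hne : i ≠ x := by rintro h; exact hxi (h ▸ Perm.SameCycle.refl _ _)
  have hrot := hjl.rotate (k + 1)
  rw [hl] at hxl
  rw [hdec] at hrot
  have hjoin := hxl.join hrot (by
    intro z hz hz'
    rw [← hdec, List.mem_rotate, hV, mem_cycleList] at hz'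
    rw [← hl, mem_cycleList] at hz
    exact hxj (hz.trans hz'.symm))
  have hxi' := sameCycle_mul_swap_of_not hxi
  have htr : IsTransversal (π * swap i x) (insert x ((otherLeaders π x).erase j)) := by
    have hout : ∀ t ∈ (otherLeaders π x).erase j, ¬ π.SameCycle t x ∧ ¬ π.SameCycle t i := by
      intro t ht
      obtain ⟨h2, h3⟩ := Finset.mem_erase.1 ht
      refine ⟨fun h => not_sameCycle_of_mem_otherLeaders h3 h.symm, fun h => h2 ?_⟩
      exact hT.2 t (by simp [h3]) j (by simp [hj]) (h.trans hji.symm)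
    have hmem : ∀ z, (π * swap i x).SameCycle x z ↔ π.SameCycle x z ∨ π.SameCycle j z := by
      intro z
      rw [← hjoin.mem_iff List.mem_cons_self, ← mem_cycleList, ← mem_cycleList, hl, ← hV,
        ← List.mem_rotate (n := k + 1) (l := V), hdec]
      simp only [List.mem_cons, List.mem_append, List.not_mem_nil, or_false]
      tauto
    constructor
    · intro z
      obtain ⟨t, ht, h⟩ := hT.1 z
      by_cases hz : t ∈ (otherLeaders π x).erase j
      · exact ⟨t, by simp only [Finset.mem_insert, hz, or_true],
          (sameCycle_mul_swap_iff (hout t hz).1 (hout t hz).2).2 h⟩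
      · refine ⟨x, by simp, (hmem z).2 ?_⟩
        rcases Finset.mem_insert.1 ht with rfl | ht
        · exact Or.inl h
        · have : t = j := by by_contra h'; exact hz (Finset.mem_erase.2 ⟨h', ht⟩)
          exact Or.inr (this ▸ h)
    · have key : ∀ w ∈ (otherLeaders π x).erase j, ∀ w' ∈ insert x ((otherLeaders π x).erase j),
          (π * swap i x).SameCycle w w' → w = w' := by
        intro w hw w' hw' h
        rw [sameCycle_mul_swap_iff (hout w hw).1 (hout w hw).2] at h
        exact hT.2 w (Finset.mem_insert_of_mem (Finset.mem_of_mem_erase hw)) w'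
          (Finset.insert_subset_insert _ (Finset.erase_subset _ _) hw') h
      intro w hw w' hw' h
      rcases Finset.mem_insert.1 hw with rfl | h1
      · rcases Finset.mem_insert.1 hw' with rfl | h2
        · rfl
        · exact (key w' h2 _ hw h.symm).symm
      · exact key w h1 w' hw' h
  rw [multExt_eq_prod hF a htr, Finset.prod_insert (by simp [hx])]
  congr 1
  · rw [cycleWord_eq_map, hjoin.cycleList_eq, ← List.map_rotate, hdec]
    simp
  · refine Finset.prod_congr rfl fun t ht => ?_
    obtain ⟨h2, h3⟩ := Finset.mem_erase.1 ht
    rw [cycleWord_eq_map, cycleWord_eq_map, cycleList_mul_swap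
      (fun h => not_sameCycle_of_mem_otherLeaders h3 h.symm)
      (fun h => h2 (hT.2 t (by simp [h3]) j (by simp [hj]) (h.trans hji.symm)))]

end

/-! ### Summation over all permutations, grouped by a base point -/

section

variable {α R : Type*} [CommRing R] {N : ℕ}

/-- The complement `π⁻¹ * γ` fixes `x`. Conjugation moves the transposition to its right, where it
joins the trivial cycle of `x` to another one. -/
theorem permLength_inv_mul_of_ne {γ π : Perm (Fin N)} {x i : Fin N} (hx : π x = γ x)
    (hi : i ≠ x) : permLength ((π * swap i x)⁻¹ * γ) = permLength (π⁻¹ * γ) + 1 := by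
  have hσ : (π⁻¹ * γ) x = x := by rw [Perm.mul_apply, ← hx, Perm.inv_eq_iff_eq]
  set σ := π⁻¹ * γ with hσ'
  have h1 : (π * swap i x)⁻¹ * γ = σ * swap (σ⁻¹ i) x := by
    have h3 : σ⁻¹ x = x := by rw [Perm.inv_eq_iff_eq, hσ]
    have h2 : swap i x = σ * swap (σ⁻¹ i) (σ⁻¹ x) * σ⁻¹ := by
      ext z
      simp [swap_apply_def]
      split_ifs <;> simp_all
    rw [mul_inv_rev, swap_inv, mul_assoc, ← hσ', h2, h3, inv_mul_cancel_right]
  rw [h1, permLength_mul_swap_of_not_sameCycle]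
  intro h
  obtain ⟨k, hk⟩ := h
  rw [Perm.zpow_apply_eq_self_of_apply_eq_self hσ, eq_comm, Perm.inv_eq_iff_eq, hσ] at hk
  exact hi hk

/-- A permutation `ρ` determines `i` as the preimage of `γ x`; then `ρ * swap i x` agrees with `γ`
at `x`. -/
theorem sum_perm_eq (γ : Perm (Fin N)) (x : Fin N) (g : Perm (Fin N) → R) :
    ∑ π, g π = ∑ π with π x = γ x, ∑ i, g (π * swap i x) := by
  rw [← Finset.sum_product']
  symm
  refine Finset.sum_bij' (fun p _ => p.1 * swap p.2 x)
    (fun π _ => (π * swap (π⁻¹ (γ x)) x, π⁻¹ (γ x))) ?_ ?_ ?_ ?_ ?_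
  · simp
  · intro π _
    simp
  · rintro ⟨π, i⟩ h
    simp only [mem_product, mem_filter, mem_univ, true_and, and_true] at h
    have : (π * swap i x)⁻¹ (γ x) = i := by
      rw [Perm.inv_eq_iff_eq, Perm.mul_apply, swap_apply_left, h]
    simp only [this, mul_assoc, swap_mul_self, mul_one]
  · intro π _
    simp only [mul_assoc, swap_mul_self, mul_one]
  · simp

/-- The complement gains one for each `i ≠ x`, while `π` loses one in a cut and gains one in a join.
So a cut keeps the defect and a join raises it by 2; only cuts of geodesic `π` stay at defect 0. -/
theorem sum_weight₁ {F : List α → R} (hF : IsCyclic F) (a : Fin N → α) (γ : Perm (Fin N))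
    (x : Fin N) :
    ∑ π, weight₁ F a γ π = ∑ π with π x = γ x,
      if permLength π + permLength (π⁻¹ * γ) = permLength γ then
        cutSum₁ F (a x) (cycleWord a π x).tail * ∏ t ∈ otherLeaders π x, F (cycleWord a π t)
      else 0 := by
  rw [sum_perm_eq γ x]
  refine Finset.sum_congr rfl fun π hπ => ?_
  replace hπ := (Finset.mem_filter.1 hπ).2
  rw [← sum_multExt_cut hF, Finset.sum_filter]
  have hle := permLength_le_add γ π
  split_ifs with hL
  · refine Finset.sum_congr rfl fun i _ => ?_
    rw [weight₁]
    rcases eq_or_ne i x with rfl | hi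
    · rw [mul_swap_self', if_pos hL, if_pos (Perm.SameCycle.refl _ _)]
    · rw [permLength_inv_mul_of_ne hπ hi]
      by_cases h : π.SameCycle x i
      · have := permLength_mul_swap_of_sameCycle h hi
        rw [if_pos h, if_pos (by omega)]
      · have := permLength_mul_swap_of_not_sameCycle h
        rw [if_neg h, if_neg (by omega)]
  · refine Finset.sum_eq_zero fun i _ => ?_
    rw [weight₁]
    rcases eq_or_ne i x with rfl | hi
    · rw [mul_swap_self', if_neg hL]
    · rw [permLength_inv_mul_of_ne hπ hi, if_neg]
      by_cases h : π.SameCycle x i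
      · have := permLength_mul_swap_of_sameCycle h hi
        omega
      · have := permLength_mul_swap_of_not_sameCycle h
        omega

theorem not_preserves_mul_swap {γ π : Perm (Fin N)} {s : Fin N → Bool} (hγ : ∀ z, s (γ z) = s z)
    {x i : Fin N} (hx : π x = γ x) (h : s i ≠ s x) : ¬ ∀ z, s ((π * swap i x) z) = s z := by
  intro h'
  have := h' i
  rw [Perm.mul_apply, swap_apply_left, hx, hγ] at this
  exact h this.symm

-- A side-preserving `π` of defect 0 contributes pair terms through its cuts and annular terms
-- through its joins with the other circle. For each cycle `j` of the other circle the terms that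
-- involve `x` and `j` add up to a multiple of `cutSum₂`, which is 0 by `hcut`. There remains
-- `cutSum₁` times the terms in which the cycle of `x` is a first order factor.
open Classical in
theorem sum_weight₂ {s : Fin N → Bool} {F₁ : List α → R} {F₂ : List α → List α → R}
    (hF₁ : IsCyclic F₁) (hF₂ : ∀ v, IsCyclic (F₂ · v)) (hF₂' : ∀ w, IsCyclic (F₂ w))
    (a : Fin N → α) {γ : Perm (Fin N)} (hγ : ∀ z, s (γ z) = s z) {x : Fin N} (hsx : s x = true)
    (hcut : ∀ π : Perm (Fin N), π x = γ x → ∀ j,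
      cutSum₂ F₁ F₂ (a x) (cycleWord a π x).tail (cycleWord a π j) = 0) :
    ∑ π, weight₂ s F₁ F₂ a γ π = ∑ π with π x = γ x,
      cutSum₁ F₁ (a x) (cycleWord a π x).tail *
        (if ∀ z, s (π z) = s z then
          if permLength π + permLength (π⁻¹ * γ) = permLength γ then
            pairSum s (fun i => F₁ (cycleWord a π i))
              (fun i j => F₂ (cycleWord a π i) (cycleWord a π j)) (otherLeaders π x)
          else 0
        else
          if permLength π + permLength (π⁻¹ * γ) = permLength γ + 2 then
            ∏ t ∈ otherLeaders π x, F₁ (cycleWord a π t)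
          else 0) := by
  rw [sum_perm_eq γ x]
  refine Finset.sum_congr rfl fun π hπ => ?_
  replace hπ := (Finset.mem_filter.1 hπ).2
  have hle := permLength_le_add γ π
  have hlen : ∀ i, i ≠ x → (permLength ((π * swap i x)⁻¹ * γ) = permLength (π⁻¹ * γ) + 1 ∧
      (π.SameCycle x i → permLength (π * swap i x) + 1 = permLength π) ∧
      (¬ π.SameCycle x i → permLength (π * swap i x) = permLength π + 1)) := fun i hi =>
    ⟨permLength_inv_mul_of_ne hπ hi, fun h => permLength_mul_swap_of_sameCycle h hi,
      fun h => permLength_mul_swap_of_not_sameCycle h⟩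
  by_cases hs : ∀ z, s (π z) = s z
  · rw [if_pos hs]
    by_cases hL : permLength π + permLength (π⁻¹ * γ) = permLength γ
    · rw [if_pos hL]
      -- A join within the circle of `x` has weight 0: it preserves the sides, but its defect is 2.
      have h1 : ∑ i, weight₂ s F₁ F₂ a γ (π * swap i x) =
          ∑ i with π.SameCycle x i, pairExt s F₁ F₂ a (π * swap i x) +
          ∑ i with s i = false, multExt F₁ a (π * swap i x) := by
        rw [Finset.sum_filter, Finset.sum_filter, ← Finset.sum_add_distrib]
        refine Finset.sum_congr rfl fun i _ => ?_
        rw [weight₂]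
        rcases eq_or_ne i x with rfl | hi
        · rw [mul_swap_self', if_pos hs, if_pos hL, if_pos (Perm.SameCycle.refl _ _),
            if_neg (by simp [hsx]), add_zero]
        · obtain ⟨h2, h3, h4⟩ := hlen i hi
          by_cases h : π.SameCycle x i
          · have hsi : s i = s x := (side_eq_of_sameCycle hs h).symm
            have := h3 h
            rw [if_pos ((mul_swap_side hsi).2 hs), if_pos (by omega), if_pos h,
              if_neg (by simp [hsi, hsx]), add_zero]
          · have := h4 h
            rw [if_neg h, zero_add]
            by_cases hsi : s i = s x
            · rw [if_pos ((mul_swap_side hsi).2 hs), if_neg (by omega),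
                if_neg (by simp [hsi, hsx])]
            · rw [if_neg (not_preserves_mul_swap hγ hπ hsi), if_pos (by omega),
                if_pos (by simpa [hsx] using hsi)]
      have h2 : ∑ i with s i = false, multExt F₁ a (π * swap i x) =
          ∑ j ∈ (otherLeaders π x).filter (fun j => s j = false),
            ∑ i with π.SameCycle j i, multExt F₁ a (π * swap i x) := by
        rw [Finset.sum_filter, sum_eq_sum_transversal (isTransversal_otherLeaders π x),
          Finset.sum_insert (notMem_otherLeaders π x), Finset.sum_eq_zero, zero_add,
          Finset.sum_filter]
        · refine Finset.sum_congr rfl fun j _ => ?_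
          split_ifs with hj
          · refine Finset.sum_congr rfl fun i hi => if_pos ?_
            rw [← side_eq_of_sameCycle hs (Finset.mem_filter.1 hi).2, hj]
          · refine Finset.sum_eq_zero fun i hi => if_neg ?_
            rwa [← side_eq_of_sameCycle hs (Finset.mem_filter.1 hi).2]
        · intro i hi
          rw [← side_eq_of_sameCycle hs (Finset.mem_filter.1 hi).2, hsx]
          simp
      rw [h1, h2, sum_pairExt_cut hF₁ hF₂ hF₂' a hs hsx, add_right_comm,
        ← Finset.sum_add_distrib, Finset.sum_eq_zero, zero_add]
      intro j hj
      have h3 := hcut π hπ j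
      rw [sum_multExt_join hF₁ a (Finset.mem_filter.1 hj).1, ← add_mul]
      rw [cutSum₂, ← cycleWord_eq_cons] at h3
      rw [h3, zero_mul]
    · rw [if_neg hL, mul_zero]
      refine Finset.sum_eq_zero fun i _ => ?_
      rw [weight₂]
      rcases eq_or_ne i x with rfl | hi
      · rw [mul_swap_self', if_pos hs, if_neg hL]
      · obtain ⟨h2, h3, h4⟩ := hlen i hi
        by_cases h : π.SameCycle x i
        · have hsi : s i = s x := (side_eq_of_sameCycle hs h).symm
          have := h3 h
          rw [if_pos ((mul_swap_side hsi).2 hs), if_neg (by omega)]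
        · have := h4 h
          have h5 : permLength (π * swap i x) + permLength ((π * swap i x)⁻¹ * γ) ≠
            permLength γ := by omega
          have h6 : permLength (π * swap i x) + permLength ((π * swap i x)⁻¹ * γ) ≠
            permLength γ + 2 := by omega
          rw [if_neg h5, if_neg h6, ite_self]
  · rw [if_neg hs]
    -- A connecting `π` has positive defect, so its joins overshoot defect 2.
    have hL0 : permLength π + permLength (π⁻¹ * γ) ≠ permLength γ := fun h =>
      hs (apply_eq_of_geodesic hγ h)
    by_cases hL : permLength π + permLength (π⁻¹ * γ) = permLength γ + 2
    · rw [if_pos hL, ← sum_multExt_cut hF₁, Finset.sum_filter]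
      refine Finset.sum_congr rfl fun i _ => ?_
      rw [weight₂]
      rcases eq_or_ne i x with rfl | hi
      · rw [mul_swap_self', if_neg hs, if_pos hL, if_pos (Perm.SameCycle.refl _ _)]
      · obtain ⟨h2, h3, h4⟩ := hlen i hi
        have hs' : ¬ ∀ z, s ((π * swap i x) z) = s z := by
          by_cases hsi : s i = s x
          · rwa [mul_swap_side hsi]
          · exact not_preserves_mul_swap hγ hπ hsi
        rw [if_neg hs']
        by_cases h : π.SameCycle x i
        · have := h3 h
          rw [if_pos (by omega), if_pos h]
        · have := h4 h
          rw [if_neg (by omega), if_neg h]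
    · rw [if_neg hL, mul_zero]
      refine Finset.sum_eq_zero fun i _ => ?_
      rw [weight₂]
      rcases eq_or_ne i x with rfl | hi
      · rw [mul_swap_self', if_neg hs, if_neg hL]
      · obtain ⟨h2, h3, h4⟩ := hlen i hi
        have hs' : ¬ ∀ z, s ((π * swap i x) z) = s z := by
          by_cases hsi : s i = s x
          · rwa [mul_swap_side hsi]
          · exact not_preserves_mul_swap hγ hπ hsi
        rw [if_neg hs']
        by_cases h : π.SameCycle x i
        · have := h3 h
          rw [if_neg (by omega)]
        · have := h4 h
          rw [if_neg (by omega)]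

end

/-! ### The explicit values of the Möbius function -/

/-- The absolute value of the Möbius function on `(1_{m+n}, γ_{m,n})`, as a function of `m`. -/
def annularNumber (n : ℕ) (m : ℕ) : ℕ :=
  (∑ i : Fin (m - 1), 2 * annularNumber n (i + 1) * catalan (m - 2 - i)) + n * catalan (m + n - 1)
termination_by m
decreasing_by have := i.isLt; omega

/-- The signed Catalan number `(-1)^{n-1} C_{n-1}`. -/
def signedCatalan (n : ℕ) : ℤ := (-1) ^ (n + 1) * catalan (n - 1)

/-- The second order analogue of `signedCatalan`. -/
def signedAnnular (m n : ℕ) : ℤ := (-1) ^ (m + n) * annularNumber n m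

/-- This is the Catalan recursion. The sign of the uncut term is opposite to that of every product.
-/
theorem signedCatalan_cut (L : ℕ) :
    signedCatalan (L + 1) + ∑ k ∈ range L, signedCatalan (L - k) * signedCatalan (k + 1) =
      if L = 0 then 1 else 0 := by
  cases L with
  | zero => simp [signedCatalan]
  | succ L =>
    rw [if_neg (by omega), signedCatalan, show L + 1 + 1 - 1 = L + 1 by omega, catalan_succ,
      ← Fin.sum_univ_eq_sum_range
        (fun k => signedCatalan (L + 1 - k) * signedCatalan (k + 1)) (L + 1)]
    push_cast
    rw [Finset.mul_sum, ← Finset.sum_add_distrib]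
    refine Finset.sum_eq_zero fun i _ => ?_
    have hi := i.isLt
    simp only [Nat.succ_eq_add_one] at hi
    rw [signedCatalan, signedCatalan, show L + 1 - (i : ℕ) - 1 = L - i by omega,
      show (i : ℕ) + 1 - 1 = i by omega]
    have h : ((-1 : ℤ)) ^ (L + 1 + 1 + 1) = - ((-1) ^ (L + 1 - (i : ℕ) + 1) * (-1) ^ ((i : ℕ) + 1 + 1)) := by
      rw [← pow_add, show L + 1 - (i : ℕ) + 1 + ((i : ℕ) + 1 + 1) = L + 1 + 1 + 1 + 1 by omega]
      ring
    rw [h]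
    ring

/-- This is the recursion of `annularNumber` with signs. Its factor 2 comes from the two sums over
cuts, which agree after reversing the order. -/
theorem signedAnnular_cut (L n : ℕ) :
    signedAnnular (L + 1) n + (∑ k ∈ range L, (signedAnnular (L - k) n * signedCatalan (k + 1) +
      signedCatalan (L - k) * signedAnnular (k + 1) n)) + n * signedCatalan (L + 1 + n) = 0 := by
  have h1 : ∑ k ∈ range L, signedAnnular (L - k) n * signedCatalan (k + 1) =
      ∑ k ∈ range L, signedCatalan (L - k) * signedAnnular (k + 1) n := by
    rw [← Finset.sum_range_reflect]
    refine Finset.sum_congr rfl fun k hk => ?_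
    rw [Finset.mem_range] at hk
    rw [show L - (L - 1 - k) = k + 1 by omega, show L - 1 - k + 1 = L - k by omega, mul_comm]
  rw [Finset.sum_add_distrib, h1, signedAnnular, annularNumber,
    ← Fin.sum_univ_eq_sum_range (fun k => signedCatalan (L - k) * signedAnnular (k + 1) n) L,
    signedCatalan, show L + 1 - 1 = L by omega]
  push_cast
  have h2 : ∀ i : Fin L, signedCatalan (L - i) * signedAnnular (i + 1) n =
      (-1) ^ (L + n) * (annularNumber n (i + 1) * catalan (L - 1 - i)) := by
    intro i
    have hi := i.isLt
    rw [signedCatalan, signedAnnular, show L - (i : ℕ) - 1 = L - 1 - i by omega]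
    have h : ((-1 : ℤ)) ^ (L + n) = (-1) ^ (L - (i : ℕ) + 1) * (-1) ^ ((i : ℕ) + 1 + n) := by
      rw [← pow_add, show L - (i : ℕ) + 1 + ((i : ℕ) + 1 + n) = L + n + 2 by omega]
      ring
    rw [h]
    ring
  simp only [h2, ← Finset.mul_sum]
  have h3 : ∑ x : Fin L, (2 * (annularNumber n (x + 1) : ℤ) * catalan (L - 1 - x)) =
      2 * ∑ x : Fin L, ((annularNumber n (x + 1) : ℤ) * catalan (L - 1 - x)) := by
    rw [Finset.mul_sum]
    exact Finset.sum_congr rfl fun _ _ => by ring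
  rw [h3]
  ring

/-! ### The signed numbers as solutions of the cut-and-join equations -/

section

variable {α : Type*}

theorem cutSum₁_signedCatalan (b : α) (l : List α) :
    cutSum₁ (fun w => signedCatalan w.length) b l = if l.length = 0 then 1 else 0 := by
  rw [← signedCatalan_cut, cutSum₁, List.length_cons]
  congr 1
  refine Finset.sum_congr rfl fun k hk => ?_
  rw [Finset.mem_range] at hk
  rw [List.length_cons, List.length_drop, List.length_take, show l.length - (k + 1) + 1 =
    l.length - k by omega, min_eq_left (by omega)]

theorem cutSum₂_signedAnnular (b : α) (l v : List α) :
    cutSum₂ (fun w => signedCatalan w.length) (fun w v => signedAnnular w.length v.length) b l v =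
      0 := by
  rw [← signedAnnular_cut l.length v.length, cutSum₂, List.length_cons]
  congr 1
  · congr 1
    refine Finset.sum_congr rfl fun k hk => ?_
    rw [Finset.mem_range] at hk
    rw [List.length_cons, List.length_drop, List.length_take, show l.length - (k + 1) + 1 =
      l.length - k by omega, min_eq_left (by omega)]
  · simp only [List.length_cons, List.length_append, List.length_rotate, Finset.sum_const,
      Finset.card_range, nsmul_eq_mul]
    rw [show v.length + l.length + 1 = l.length + 1 + v.length by ring]

theorem isCyclic_length {S : Type*} (f : ℕ → S) : IsCyclic fun w : List α => f w.length :=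
  fun l k => by simp

theorem apply_eq_of_tail_eq_nil {N : ℕ} (a : Fin N → α) {π : Perm (Fin N)} {x : Fin N}
    (h : (cycleWord a π x).tail = []) : π x = x := by
  obtain ⟨l, hl⟩ := exists_cycleList_eq_cons π x
  rw [cycleWord_eq_map, hl] at h
  simp only [List.map_cons, List.tail_cons, List.map_eq_nil_iff] at h
  have := (isCycleList_cycleList π x).2.2
  rw [hl, h] at this
  simpa using this

/-- Since `π x = γ x ≠ x`, the cycle of `x` has at least two points and `cutSum₁` vanishes. -/
theorem sum_weight₁_signedCatalan {N : ℕ} (a : Fin N → α) {γ : Perm (Fin N)} {x : Fin N}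
    (hx : γ x ≠ x) : ∑ π, weight₁ (fun w => signedCatalan w.length) a γ π = 0 := by
  rw [sum_weight₁ (isCyclic_length _) a γ x]
  refine Finset.sum_eq_zero fun π hπ => ?_
  replace hπ := (Finset.mem_filter.1 hπ).2
  have h : (cycleWord a π x).tail.length ≠ 0 := fun h =>
    hx (hπ ▸ apply_eq_of_tail_eq_nil a (List.eq_nil_of_length_eq_zero h))
  rw [cutSum₁_signedCatalan, if_neg h, zero_mul, ite_self]

/-- If `γ` moves `x`, then `cutSum₁` vanishes. Otherwise `x` is alone on its circle: no other cycle
can be the first member of a joined pair, and no `π` that fixes `x` connects the circles. -/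
theorem sum_weight₂_signedAnnular {N : ℕ} (s : Fin N → Bool) (a : Fin N → α) {γ : Perm (Fin N)}
    (hγ : ∀ z, s (γ z) = s z) {x : Fin N} (hsx : s x = true)
    (hx : γ x = x → ∀ z, s z = true → z = x) :
    ∑ π, weight₂ s (fun w => signedCatalan w.length)
      (fun w v => signedAnnular w.length v.length) a γ π = 0 := by
  rw [sum_weight₂ (isCyclic_length _) (fun v => isCyclic_length (fun k => signedAnnular k v.length))
    (fun w => isCyclic_length _) a hγ hsx fun π _ j => cutSum₂_signedAnnular _ _ _]
  refine Finset.sum_eq_zero fun π hπ => ?_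
  replace hπ := (Finset.mem_filter.1 hπ).2
  rw [cutSum₁_signedCatalan]
  split_ifs with h1 h2 h3 h4 <;> try simp
  · have h4 := apply_eq_of_tail_eq_nil a (List.eq_nil_of_length_eq_zero h1)
    refine Finset.sum_eq_zero fun i hi => Finset.sum_eq_zero fun j _ => if_neg ?_
    rintro ⟨h5, -⟩
    exact notMem_otherLeaders π x (hx (hπ ▸ h4) i h5 ▸ hi)
  · exfalso
    have h5 := apply_eq_of_tail_eq_nil a (List.eq_nil_of_length_eq_zero h1)
    have h6 := hx (hπ ▸ h5)
    refine h2 fun z => ?_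
    cases hz : s z with
    | true => rw [h6 z hz, h5, hsx]
    | false =>
      by_contra h7
      have h8 := h6 (π z) (by simpa using h7)
      rw [← h5] at h8
      rw [π.injective h8, hsx] at hz
      simp at hz

end

/-! ### Permutations of the annulus that preserve both circles -/

section

variable {m n : ℕ}

/-- The permutation `π₁ × π₂` of `m + n` points. -/
def glue (m n : ℕ) : Perm (Fin m) × Perm (Fin n) →* Perm (Fin (m + n)) :=
  (finSumFinEquiv.permCongrHom).toMonoidHom.comp (Perm.sumCongrHom (Fin m) (Fin n))

theorem annularRotate_eq_glue : annularRotate m n = glue m n (finRotate m, finRotate n) := rfl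

@[simp] theorem glue_castAdd (p : Perm (Fin m) × Perm (Fin n)) (i : Fin m) :
    glue m n p (Fin.castAdd n i) = Fin.castAdd n (p.1 i) := by
  simp [glue, permCongr_apply]

@[simp] theorem glue_natAdd (p : Perm (Fin m) × Perm (Fin n)) (j : Fin n) :
    glue m n p (Fin.natAdd m j) = Fin.natAdd m (p.2 j) := by
  simp [glue, permCongr_apply]

/-- The circle on which a point lies: `true` for the first `m` points. -/
def side (m n : ℕ) (z : Fin (m + n)) : Bool := decide ((z : ℕ) < m)

@[simp] theorem side_castAdd (i : Fin m) : side m n (Fin.castAdd n i) = true := by simp [side]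

@[simp] theorem side_natAdd (j : Fin n) : side m n (Fin.natAdd m j) = false := by simp [side]

theorem side_glue (p : Perm (Fin m) × Perm (Fin n)) (z : Fin (m + n)) :
    side m n (glue m n p z) = side m n z := by
  induction z using Fin.addCases <;> simp

theorem side_annularRotate (z : Fin (m + n)) : side m n (annularRotate m n z) = side m n z := by
  rw [annularRotate_eq_glue, side_glue]

theorem exists_glue_eq {π : Perm (Fin (m + n))} (h : ∀ z, side m n (π z) = side m n z) :
    ∃ p, glue m n p = π := by
  have h1 : finSumFinEquiv.permCongr.symm π ∈ (Perm.sumCongrHom (Fin m) (Fin n)).range := by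
    apply Perm.mem_sumCongrHom_range_of_perm_mapsTo_inl
    rintro _ ⟨i, rfl⟩
    have := h (Fin.castAdd n i)
    simp only [side_castAdd] at this
    simp only [Set.mem_range]
    refine ⟨⟨π (Fin.castAdd n i), by simpa [side] using this⟩, ?_⟩
    rw [permCongr_symm_apply, Equiv.eq_symm_apply]
    ext
    simp
  obtain ⟨p, hp⟩ := h1
  refine ⟨p, ?_⟩
  rw [Equiv.eq_symm_apply] at hp
  exact hp

theorem glue_injective : Function.Injective (glue m n) :=
  (finSumFinEquiv.permCongrHom).injective.comp Perm.sumCongrHom_injective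

theorem sameCycle_glue_castAdd (p : Perm (Fin m) × Perm (Fin n)) (i j : Fin m) :
    (glue m n p).SameCycle (Fin.castAdd n i) (Fin.castAdd n j) ↔ p.1.SameCycle i j := by
  refine exists_congr fun k => ?_
  rw [← map_zpow, glue_castAdd]
  simp

theorem sameCycle_glue_natAdd (p : Perm (Fin m) × Perm (Fin n)) (i j : Fin n) :
    (glue m n p).SameCycle (Fin.natAdd m i) (Fin.natAdd m j) ↔ p.2.SameCycle i j := by
  refine exists_congr fun k => ?_
  rw [← map_zpow, glue_natAdd]
  simp

theorem not_sameCycle_glue (p : Perm (Fin m) × Perm (Fin n)) (i : Fin m) (j : Fin n) :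
    ¬ (glue m n p).SameCycle (Fin.castAdd n i) (Fin.natAdd m j) := by
  intro h
  have := side_eq_of_sameCycle (side_glue p) h
  simp at this

theorem leaders_glue (p : Perm (Fin m) × Perm (Fin n)) :
    leaders (glue m n p) =
      (leaders p.1).map (Fin.castAddEmb n) ∪ (leaders p.2).map (Fin.natAddEmb m) := by
  ext z
  simp only [mem_union, mem_map, mem_leaders]
  induction z using Fin.addCases with
  | left i =>
    constructor
    · intro h
      exact Or.inl ⟨i, fun j hj => h _ ((sameCycle_glue_castAdd p i j).2 hj), rfl⟩
    · rintro (⟨i', h, hi⟩ | ⟨j, -, hj⟩)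
      · obtain rfl : i' = i := by simpa using hi
        intro w hw
        induction w using Fin.addCases with
        | left j => exact h j ((sameCycle_glue_castAdd p _ j).1 hw)
        | right j => exact absurd hw (not_sameCycle_glue p _ j)
      · have := congrArg (side m n) hj
        simp at this
  | right i =>
    constructor
    · intro h
      exact Or.inr ⟨i, fun j hj => by simpa using h _ ((sameCycle_glue_natAdd p i j).2 hj), rfl⟩
    · rintro (⟨j, -, hj⟩ | ⟨i', h, hi⟩)
      · have := congrArg (side m n) hj
        simp at this
      · obtain rfl : i' = i := by simpa using hi
        intro w hw
        induction w using Fin.addCases with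
        | left j => exact absurd hw.symm (not_sameCycle_glue p j _)
        | right j => simpa using h j ((sameCycle_glue_natAdd p _ j).1 hw)

theorem disjoint_castAdd_natAdd (S : Finset (Fin m)) (T : Finset (Fin n)) :
    Disjoint (S.map (Fin.castAddEmb n)) (T.map (Fin.natAddEmb m)) := by
  rw [Finset.disjoint_left]
  intro z hz hz'
  obtain ⟨i, -, rfl⟩ := Finset.mem_map.1 hz
  obtain ⟨j, -, hj⟩ := Finset.mem_map.1 hz'
  have := congrArg (side m n) hj
  simp at this

theorem permLength_glue (p : Perm (Fin m) × Perm (Fin n)) :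
    permLength (glue m n p) = permLength p.1 + permLength p.2 := by
  have h1 := Finset.card_le_univ (leaders p.1)
  have h2 := Finset.card_le_univ (leaders p.2)
  simp only [Fintype.card_fin] at h1 h2
  rw [permLength, leaders_glue, Finset.card_union_of_disjoint (disjoint_castAdd_natAdd _ _),
    Finset.card_map, Finset.card_map, permLength, permLength]
  omega

variable {α R : Type*} [CommRing R]

theorem cycleWord_glue_castAdd (a : Fin m → α) (b : Fin n → α) (p : Perm (Fin m) × Perm (Fin n))
    (i : Fin m) :
    cycleWord (Fin.append a b) (glue m n p) (Fin.castAdd n i) = cycleWord a p.1 i := by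
  have h : (univ.filter fun j => (glue m n p).SameCycle (Fin.castAdd n i) j) =
      (univ.filter fun j => p.1.SameCycle i j).map (Fin.castAddEmb n) := by
    ext z
    simp only [mem_filter, mem_univ, true_and, mem_map]
    induction z using Fin.addCases with
    | left j => simp [sameCycle_glue_castAdd]
    | right j =>
      simp only [not_sameCycle_glue, false_iff]
      rintro ⟨k, -, hk⟩
      have := congrArg (side m n) hk
      simp at this
  rw [cycleWord, cycleWord, h, Finset.card_map]
  refine List.map_congr_left fun k _ => ?_
  rw [← map_pow, glue_castAdd, Fin.append_left]
  rfl

theorem cycleWord_glue_natAdd (a : Fin m → α) (b : Fin n → α) (p : Perm (Fin m) × Perm (Fin n))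
    (i : Fin n) :
    cycleWord (Fin.append a b) (glue m n p) (Fin.natAdd m i) = cycleWord b p.2 i := by
  have h : (univ.filter fun j => (glue m n p).SameCycle (Fin.natAdd m i) j) =
      (univ.filter fun j => p.2.SameCycle i j).map (Fin.natAddEmb m) := by
    ext z
    simp only [mem_filter, mem_univ, true_and, mem_map]
    induction z using Fin.addCases with
    | right j => simp [sameCycle_glue_natAdd]
    | left j =>
      refine iff_of_false (fun h => not_sameCycle_glue p j i h.symm) ?_
      rintro ⟨k, -, hk⟩
      have := congrArg (side m n) hk
      simp at this
  rw [cycleWord, cycleWord, h, Finset.card_map]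
  refine List.map_congr_left fun k _ => ?_
  rw [← map_pow, glue_natAdd, Fin.append_right]
  rfl

theorem pairExt_glue (F₁ : List α → R) (F₂ : List α → List α → R) (a : Fin m → α) (b : Fin n → α)
    (p : Perm (Fin m) × Perm (Fin n)) :
    pairExt (side m n) F₁ F₂ (Fin.append a b) (glue m n p) =
      ∑ i ∈ leaders p.1, ∑ j ∈ leaders p.2, F₂ (cycleWord a p.1 i) (cycleWord b p.2 j) *
        (multExtErase F₁ a p.1 i * multExtErase F₁ b p.2 j) := by
  have hd := disjoint_castAdd_natAdd (leaders p.1) (leaders p.2)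
  rw [pairExt, pairSum, leaders_glue, Finset.sum_union hd, Finset.sum_map, Finset.sum_map,
    add_eq_left.2]
  · refine Finset.sum_congr rfl fun i hi => ?_
    rw [Finset.sum_union hd, Finset.sum_map, Finset.sum_map, add_eq_right.2]
    · refine Finset.sum_congr rfl fun j hj => ?_
      simp only [Fin.castAddEmb_apply, Fin.natAddEmb_apply, side_castAdd, side_natAdd, and_self,
        if_true, cycleWord_glue_castAdd, cycleWord_glue_natAdd]
      congr 1
      have h1 : (((leaders p.1).map (Fin.castAddEmb n) ∪ (leaders p.2).map (Fin.natAddEmb m)).erase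
          (Fin.castAdd n i)).erase (Fin.natAdd m j) =
          ((leaders p.1).erase i).map (Fin.castAddEmb n) ∪
            ((leaders p.2).erase j).map (Fin.natAddEmb m) := by
        rw [Finset.map_erase, Finset.map_erase, Finset.erase_union_distrib,
          Finset.erase_union_distrib]
        congr 1
        · rw [Finset.erase_eq_of_notMem]
          · rfl
          · intro h
            obtain ⟨k, -, hk⟩ := Finset.mem_map.1 (Finset.mem_of_mem_erase h)
            have := congrArg (side m n) hk
            simp at this
        · rw [Finset.erase_eq_of_notMem (a := Fin.castAdd n i)]
          · rfl
          · intro h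
            obtain ⟨k, -, hk⟩ := Finset.mem_map.1 h
            have := congrArg (side m n) hk
            simp at this
      rw [h1, Finset.prod_union (disjoint_castAdd_natAdd _ _), Finset.prod_map, Finset.prod_map,
        multExtErase, multExtErase]
      simp only [Fin.castAddEmb_apply, Fin.natAddEmb_apply, cycleWord_glue_castAdd,
        cycleWord_glue_natAdd]
    · exact Finset.sum_eq_zero fun j _ => if_neg (by simp)
  · exact Finset.sum_eq_zero fun j _ => Finset.sum_eq_zero fun k _ => if_neg (by simp)

theorem sum_NC_eq (F : List α → R) (a : Fin n → α) :
    ∑ π ∈ NC n, multExt F a π = ∑ π, weight₁ F a (finRotate n) π := by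
  rw [NC, Finset.sum_filter]
  rfl

theorem not_preserves_side_iff (π : Perm (Fin (m + n))) :
    (∃ (i : Fin m) (j : Fin n), π.SameCycle (Fin.castAdd n i) (Fin.natAdd m j)) ↔
      ¬ ∀ z, side m n (π z) = side m n z := by
  constructor
  · rintro ⟨i, j, h⟩ hs
    have := side_eq_of_sameCycle hs h
    simp at this
  · intro h
    push Not at h
    obtain ⟨z, hz⟩ := h
    have hc : π.SameCycle z (π z) := ⟨1, by simp⟩
    revert hz hc
    generalize π z = w
    induction z using Fin.addCases <;> induction w using Fin.addCases
    · simp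
    · exact fun _ h => ⟨_, _, h⟩
    · exact fun _ h => ⟨_, _, h.symm⟩
    · simp

/-- The permutations that do not preserve the sides give `annularNC`; those that do are the products
`π₁ × π₂`, by `exists_glue_eq`. -/
theorem sum_annular_eq (F₁ : List α → R) (F₂ : List α → List α → R) (a : Fin m → α)
    (b : Fin n → α) :
    (∑ π ∈ annularNC m n, multExt F₁ (Fin.append a b) π) +
      ∑ π₁ ∈ NC m, ∑ π₂ ∈ NC n, ∑ i ∈ leaders π₁, ∑ j ∈ leaders π₂,
        F₂ (cycleWord a π₁ i) (cycleWord b π₂ j) *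
          (multExtErase F₁ a π₁ i * multExtErase F₁ b π₂ j) =
      ∑ π, weight₂ (side m n) F₁ F₂ (Fin.append a b) (annularRotate m n) π := by
  classical
  rw [← Finset.sum_filter_not_add_sum_filter univ fun π => ∀ z, side m n (π z) = side m n z]
  congr 1
  · rw [annularNC, Finset.sum_filter, Finset.sum_filter]
    refine Finset.sum_congr rfl fun π _ => ?_
    have h := not_preserves_side_iff π
    by_cases hs : ∀ z, side m n (π z) = side m n z
    · rw [if_neg fun h' => h.1 h'.1 hs, if_neg (not_not.2 hs)]
    · rw [if_pos hs, weight₂, if_neg hs]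
      simp only [h.2 hs, true_and]
  · rw [← Finset.sum_product']
    symm
    have h1 : (univ.filter fun π : Perm (Fin (m + n)) => ∀ z, side m n (π z) = side m n z) =
        univ.map ⟨glue m n, glue_injective⟩ := by
      ext π
      simp only [mem_filter, mem_univ, true_and, mem_map, Function.Embedding.coeFn_mk]
      constructor
      · exact exists_glue_eq
      · rintro ⟨p, rfl⟩ z
        exact side_glue p z
    have h2 : NC m ×ˢ NC n = univ.filter fun p : Perm (Fin m) × Perm (Fin n) =>
        permLength (glue m n p) + permLength ((glue m n p)⁻¹ * annularRotate m n) =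
          permLength (annularRotate m n) := by
      ext p
      simp only [mem_product, NC, mem_filter, mem_univ, true_and]
      rw [annularRotate_eq_glue, ← map_inv, ← map_mul, permLength_glue, permLength_glue,
        permLength_glue]
      -- The defect is additive and nonnegative, so it is 0 exactly when both factors are
      -- non-crossing.
      have h3 := permLength_le_add (finRotate m) p.1
      have h4 := permLength_le_add (finRotate n) p.2
      simp only [Prod.fst_mul, Prod.fst_inv, Prod.snd_mul, Prod.snd_inv]
      omega
    rw [h1, Finset.sum_map, h2, Finset.sum_filter]
    refine Finset.sum_congr rfl fun p _ => ?_
    simp only [Function.Embedding.coeFn_mk]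
    rw [weight₂, if_pos (side_glue p), pairExt_glue]

end

/-! ### Alternating words -/

/-- The word `(a, -a, a, -a, …)` of length `2k`. -/
def altWord (a : SignType) : ℕ → List SignType
  | 0 => []
  | k + 1 => a :: -a :: altWord a k

theorem signType_ne_neg_self {a : SignType} (ha : a ≠ 0) : a ≠ -a := by
  revert a; decide

theorem signType_eq_or_eq_neg {a b : SignType} (ha : a ≠ 0) (hb : b ≠ 0) : b = a ∨ b = -a := by
  revert a b; decide

theorem signType_neg_ne_zero {a : SignType} (ha : a ≠ 0) : -a ≠ 0 := by
  revert a; decide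

@[simp] theorem length_altWord (a : SignType) (k : ℕ) : (altWord a k).length = 2 * k := by
  induction k with
  | zero => rfl
  | succ k ih => simp [altWord, ih]; ring

theorem altWord_add (a : SignType) (i j : ℕ) :
    altWord a (i + j) = altWord a i ++ altWord a j := by
  induction i with
  | zero => simp [altWord]
  | succ i ih => rw [add_right_comm]; simp [altWord, ih]

theorem cons_altWord_neg (a : SignType) (k : ℕ) : a :: altWord (-a) k = altWord a k ++ [a] := by
  induction k with
  | zero => rfl
  | succ k ih => simp [altWord, ← ih]

theorem rotate_one_altWord (a : SignType) (k : ℕ) : (altWord a k).rotate 1 = altWord (-a) k := by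
  cases k with
  | zero => rfl
  | succ k => simp [altWord, ← cons_altWord_neg]

theorem rotate_altWord (a : SignType) (k r : ℕ) :
    (altWord a k).rotate (2 * r) = altWord a k ∧ (altWord a k).rotate (2 * r + 1) = altWord (-a) k := by
  have h : (altWord a k).rotate (2 * r) = altWord a k := by
    induction r with
    | zero => simp
    | succ r ih =>
      rw [show 2 * (r + 1) = 2 * r + 1 + 1 by ring, ← List.rotate_rotate, ← List.rotate_rotate, ih,
        rotate_one_altWord, rotate_one_altWord, neg_neg]
  exact ⟨h, by rw [← List.rotate_rotate, h, rotate_one_altWord]⟩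

theorem altWord_eq_append {a : SignType} {K : ℕ} {p q : List SignType} (h : altWord a K = p ++ q) :
    ∃ i j, (p = altWord a i ∧ q = altWord a j) ∨ (p = altWord a i ++ [a] ∧ q = -a :: altWord a j) := by
  induction K generalizing p with
  | zero =>
    obtain ⟨rfl, rfl⟩ := List.append_eq_nil_iff.1 h.symm
    exact ⟨0, 0, Or.inl ⟨rfl, rfl⟩⟩
  | succ K ih =>
    match p, h with
    | [], h => exact ⟨0, K + 1, Or.inl ⟨rfl, h.symm⟩⟩
    | [b], h =>
      simp only [altWord, List.cons_append, List.nil_append, List.cons.injEq] at h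
      exact ⟨0, K, Or.inr ⟨by simp [altWord, h.1], h.2.symm⟩⟩
    | b :: c :: p, h =>
      simp only [altWord, List.cons_append, List.cons.injEq] at h
      obtain ⟨rfl, rfl, h⟩ := h
      obtain ⟨i, j, ⟨h1, h2⟩ | ⟨h1, h2⟩⟩ := ih h
      · exact ⟨i + 1, j, Or.inl ⟨by simp [altWord, h1], h2⟩⟩
      · exact ⟨i + 1, j, Or.inr ⟨by simp [altWord, h1], h2⟩⟩

/-- `w` is a non-empty cyclically alternating word without zeros. -/
def IsAlternating (w : List SignType) : Prop := ∃ a ≠ 0, ∃ k, w = altWord a (k + 1)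

theorem IsAlternating.even_length {w : List SignType} (h : IsAlternating w) : Even w.length := by
  obtain ⟨a, -, k, rfl⟩ := h
  simp

theorem IsAlternating.zero_notMem {w : List SignType} (h : IsAlternating w) : 0 ∉ w := by
  obtain ⟨a, ha, k, rfl⟩ := h
  generalize k + 1 = n
  induction n with
  | zero => simp [altWord]
  | succ n ih => simp [altWord, ih, ha.symm, (signType_neg_ne_zero ha).symm]

theorem IsAlternating.eq_altWord {a : SignType} {l : List SignType} (h : IsAlternating (a :: l)) :
    a ≠ 0 ∧ ∃ k, a :: l = altWord a (k + 1) := by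
  obtain ⟨b, hb, k, hk⟩ := h
  obtain rfl : a = b := (List.cons.inj hk).1
  exact ⟨hb, k, hk⟩

theorem IsAlternating.rotate {w : List SignType} (h : IsAlternating w) (k : ℕ) :
    IsAlternating (w.rotate k) := by
  obtain ⟨a, ha, n, rfl⟩ := h
  obtain ⟨r, rfl | rfl⟩ := Nat.even_or_odd' k
  · exact ⟨a, ha, n, (rotate_altWord a _ r).1⟩
  · exact ⟨-a, signType_neg_ne_zero ha, n, (rotate_altWord a _ r).2⟩

theorem isAlternating_rotate_iff {w : List SignType} {k : ℕ} :
    IsAlternating (w.rotate k) ↔ IsAlternating w := by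
  refine ⟨fun h => ?_, fun h => h.rotate k⟩
  obtain ⟨k', hk'⟩ := (List.IsRotated.forall w k)
  rw [← hk']
  exact h.rotate k'

theorem isAlternating_join {a : SignType} {p q : List SignType} (hp : IsAlternating (-a :: p))
    (hq : IsAlternating (a :: q)) : IsAlternating (a :: -a :: (p ++ q)) := by
  obtain ⟨-, i, hi⟩ := hp.eq_altWord
  obtain ⟨ha, j, hj⟩ := hq.eq_altWord
  refine ⟨a, ha, i + 1 + j, ?_⟩
  rw [add_assoc, altWord_add, ← hj, ← List.cons_append, hi, ← List.cons_append, cons_altWord_neg]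
  simp

/-- In the alternating word `p` stands between `a` and `-a`, so it starts with `-a` and ends with
`a`; deleting it leaves an alternating word. -/
theorem isAlternating_of_join {a : SignType} {p q : List SignType} (hp : p ≠ [])
    (h : IsAlternating (a :: (p ++ -a :: q))) : IsAlternating p ∧ IsAlternating (a :: -a :: q) := by
  obtain ⟨ha, K, hK⟩ := h.eq_altWord
  obtain ⟨i, j, ⟨h1, h2⟩ | ⟨h1, h2⟩⟩ := altWord_eq_append (p := a :: p) (q := -a :: q)
    (by rw [← hK]; rfl)
  · cases j with
    | zero => simp [altWord] at h2
    | succ j => exact absurd (List.cons.inj h2).1.symm (signType_ne_neg_self ha)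
  · rw [← cons_altWord_neg] at h1
    obtain rfl := (List.cons.inj h1).2
    obtain rfl := (List.cons.inj h2).2
    refine ⟨⟨-a, signType_neg_ne_zero ha, i - 1, ?_⟩, a, ha, j, rfl⟩
    rw [Nat.sub_add_cancel]
    by_contra hi
    obtain rfl : i = 0 := by omega
    exact hp rfl

/-! ### The candidate cumulants and their cut sums -/

open Classical in
/-- The first order cumulants of a Haar unitary and its adjoint (the letters `1` and `-1`), and of
the unit (the letter `0`). -/
noncomputable def altFun₁ (w : List SignType) : ℤ :=
  if w = [0] then 1 else if IsAlternating w then signedCatalan (w.length / 2) else 0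

open Classical in
/-- The second order analogue of `altFun₁`. -/
noncomputable def altFun₂ (w v : List SignType) : ℤ :=
  if IsAlternating w ∧ IsAlternating v then signedAnnular (w.length / 2) (v.length / 2) else 0

theorem altFun₁_of_isAlternating {w : List SignType} (h : IsAlternating w) :
    altFun₁ w = signedCatalan (w.length / 2) := by
  rw [altFun₁, if_neg, if_pos h]
  rintro rfl
  exact h.zero_notMem (by simp)

theorem altFun₁_altWord {a : SignType} (ha : a ≠ 0) {k : ℕ} (hk : k ≠ 0) :
    altFun₁ (altWord a k) = signedCatalan k := by
  obtain ⟨k, rfl⟩ := Nat.exists_eq_succ_of_ne_zero hk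
  rw [altFun₁_of_isAlternating ⟨a, ha, k, rfl⟩]
  simp

theorem isAlternating_of_altFun₁_ne_zero {b : SignType} {l : List SignType} (hb : b ≠ 0)
    (h : altFun₁ (b :: l) ≠ 0) : IsAlternating (b :: l) := by
  rw [altFun₁, if_neg (by simp [hb])] at h
  by_contra h'
  exact h (if_neg h')

theorem altFun₂_altWord {a b : SignType} (ha : a ≠ 0) (hb : b ≠ 0) {k n : ℕ} (hk : k ≠ 0)
    (hn : n ≠ 0) : altFun₂ (altWord a k) (altWord b n) = signedAnnular k n := by
  obtain ⟨k, rfl⟩ := Nat.exists_eq_succ_of_ne_zero hk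
  obtain ⟨n, rfl⟩ := Nat.exists_eq_succ_of_ne_zero hn
  rw [altFun₂, if_pos ⟨⟨a, ha, k, rfl⟩, ⟨b, hb, n, rfl⟩⟩]
  simp

theorem isAlternating_of_altFun₂_ne_zero {w v : List SignType} (h : altFun₂ w v ≠ 0) :
    IsAlternating w ∧ IsAlternating v := by
  by_contra h'
  exact h (if_neg h')

theorem isCyclic_altFun₁ : IsCyclic altFun₁ := by
  intro l k
  rw [altFun₁, altFun₁, isAlternating_rotate_iff, List.length_rotate]
  congr 1
  rw [List.rotate_eq_singleton_iff]

theorem isCyclic_altFun₂_left (v : List SignType) : IsCyclic (altFun₂ · v) := by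
  intro l k
  change altFun₂ _ _ = altFun₂ _ _
  rw [altFun₂, altFun₂, isAlternating_rotate_iff, List.length_rotate]

theorem isCyclic_altFun₂_right (w : List SignType) : IsCyclic (altFun₂ w) := by
  intro l k
  rw [altFun₂, altFun₂, isAlternating_rotate_iff, List.length_rotate]

/-- In a cut sum the index `j` stands for cutting off `j + 1` letters. For even `j` the piece has
odd length and is not alternating. -/
theorem sum_range_odd {g : ℕ → ℤ} {k : ℕ} (hg : ∀ i, 2 * i < 2 * k + 1 → g (2 * i) = 0) :
    ∑ j ∈ range (2 * k + 1), g j = ∑ i ∈ range k, g (2 * i + 1) := by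
  induction k with
  | zero => simpa using hg 0
  | succ k ih =>
    rw [show 2 * (k + 1) + 1 = 2 * k + 1 + 1 + 1 by ring, Finset.sum_range_succ,
      Finset.sum_range_succ, ih fun i hi => hg i (by omega), Finset.sum_range_succ,
      show 2 * k + 1 + 1 = 2 * (k + 1) by ring, hg (k + 1) (by omega), add_zero]

theorem sum_range_two_mul {g : ℕ → ℤ} {c : ℤ} (n : ℕ) (hg : ∀ i, g (2 * i) + g (2 * i + 1) = c) :
    ∑ j ∈ range (2 * n), g j = n * c := by
  induction n with
  | zero => simp
  | succ n ih =>
    rw [show 2 * (n + 1) = 2 * n + 1 + 1 by ring, Finset.sum_range_succ,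
      Finset.sum_range_succ, ih, add_assoc, hg]
    push_cast
    ring

theorem not_isAlternating_take_even (a : SignType) (k i : ℕ) (hi : 2 * i < 2 * k + 1) :
    ¬ IsAlternating ((-a :: altWord a k).take (2 * i + 1)) := by
  intro h
  have := h.even_length
  rw [List.length_take, min_eq_left (by simp; omega)] at this
  exact absurd this (by simp)

theorem altFun₁_take_even {a : SignType} (ha : a ≠ 0) (k i : ℕ) (hi : 2 * i < 2 * k + 1) :
    altFun₁ ((-a :: altWord a k).take (2 * i + 1)) = 0 := by
  by_contra h
  rw [List.take_succ_cons] at h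
  have := isAlternating_of_altFun₁_ne_zero (signType_neg_ne_zero ha) h
  rw [← List.take_succ_cons] at this
  exact not_isAlternating_take_even a k i hi this

theorem take_drop_odd (a : SignType) (k i : ℕ) (hi : i < k) :
    (-a :: altWord a k).take (2 * i + 1 + 1) = altWord (-a) (i + 1) ∧
    a :: (-a :: altWord a k).drop (2 * i + 1 + 1) = altWord a (k - i) := by
  have h1 := cons_altWord_neg (-a) k
  rw [neg_neg] at h1
  have h2 : altWord (-a) k = altWord (-a) (i + 1) ++ altWord (-a) (k - i - 1) := by
    rw [← altWord_add]; congr 1; omega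
  have hl : (altWord (-a) (i + 1)).length = 2 * i + 1 + 1 := by rw [length_altWord]; ring
  rw [h1, h2, List.append_assoc, List.take_left' hl, List.drop_left' hl]
  refine ⟨rfl, ?_⟩
  have h3 := cons_altWord_neg (-a) (k - i - 1)
  rw [neg_neg] at h3
  rw [← h3, show k - i = (k - i - 1) + 1 by omega]
  rfl

/-- On an alternating word only cuts into even pieces count, and they reproduce `signedCatalan_cut`
for the half lengths. On any other word every term is 0, since two alternating pieces would
reassemble to an alternating word. -/
theorem cutSum₁_altFun₁ {a : SignType} (ha : a ≠ 0) (l : List SignType) :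
    cutSum₁ altFun₁ a (-a :: l) = if l = [] then 1 else 0 := by
  by_cases hw : IsAlternating (a :: -a :: l)
  · obtain ⟨-, k, hk⟩ := hw.eq_altWord
    obtain rfl : l = altWord a k := by simpa [altWord] using hk
    have h0 : (altWord a k = []) ↔ k = 0 := by rw [← List.length_eq_zero_iff]; simp
    simp only [h0]
    rw [← signedCatalan_cut, cutSum₁, List.length_cons, length_altWord, sum_range_odd]
    · congr 1
      · exact altFun₁_altWord ha (Nat.succ_ne_zero k)
      · refine Finset.sum_congr rfl fun i hi => ?_
        rw [Finset.mem_range] at hi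
        obtain ⟨h1, h2⟩ := take_drop_odd a k i hi
        rw [h1, h2, altFun₁_altWord ha (by omega),
          altFun₁_altWord (signType_neg_ne_zero ha) (by omega)]
    · intro i hi
      rw [altFun₁_take_even ha k i hi, mul_zero]
  · have hl : l ≠ [] := by
      rintro rfl
      exact hw ⟨a, ha, 0, rfl⟩
    rw [if_neg hl, cutSum₁, Finset.sum_eq_zero, add_zero]
    · by_contra h
      exact hw (isAlternating_of_altFun₁_ne_zero ha h)
    · intro k _
      by_contra h
      have h1 := isAlternating_of_altFun₁_ne_zero ha (left_ne_zero_of_mul h)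
      have h2 := right_ne_zero_of_mul h
      rw [List.take_succ_cons] at h2
      have h3 := isAlternating_join
        (isAlternating_of_altFun₁_ne_zero (signType_neg_ne_zero ha) h2) h1
      rw [List.drop_succ_cons, List.take_append_drop] at h3
      exact hw h3

/-- As in first order, the alternating case is `signedAnnular_cut` for the half lengths, and
otherwise every cut and every join vanishes. -/
theorem cutSum₂_altFun₂ {a : SignType} (ha : a ≠ 0) (l v : List SignType) :
    cutSum₂ altFun₁ altFun₂ a (-a :: l) v = 0 := by
  by_cases hw : IsAlternating (a :: -a :: l) ∧ IsAlternating v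
  · obtain ⟨-, k, hk⟩ := hw.1.eq_altWord
    obtain ⟨b, hb, n, rfl⟩ := hw.2
    obtain rfl : l = altWord a k := by simpa [altWord] using hk
    rw [← signedAnnular_cut k (n + 1), cutSum₂, List.length_cons, length_altWord, sum_range_odd]
    · congr 1
      · congr 1
        · exact altFun₂_altWord ha hb (Nat.succ_ne_zero k) (Nat.succ_ne_zero n)
        · refine Finset.sum_congr rfl fun i hi => ?_
          rw [Finset.mem_range] at hi
          have ha' := signType_neg_ne_zero ha
          obtain ⟨h1, h2⟩ := take_drop_odd a k i hi
          rw [h1, h2, altFun₁_altWord ha (by omega), altFun₁_altWord ha' (by omega),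
            altFun₂_altWord ha hb (by omega) (by omega),
            altFun₂_altWord ha' hb (by omega) (by omega)]
      · rw [length_altWord]
        have h1 : altFun₁ (a :: (altWord (-a) (n + 1) ++ -a :: altWord a k)) =
            signedCatalan (k + 1 + (n + 1)) := by
          rw [← List.cons_append, cons_altWord_neg, List.append_assoc,
            show [a] ++ -a :: altWord a k = altWord a (k + 1) from rfl, ← altWord_add,
            altFun₁_altWord ha (by omega), add_comm]
        have h2 : altFun₁ (a :: (altWord a (n + 1) ++ -a :: altWord a k)) = 0 := by
          by_contra h
          obtain ⟨-, K, hK⟩ := (isAlternating_of_altFun₁_ne_zero ha h).eq_altWord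
          simp only [altWord, List.cons_append, List.cons.injEq] at hK
          exact signType_ne_neg_self ha hK.2.1
        -- Of two consecutive rotations of `v` exactly one fits between `a` and `-a`. So half of the
        -- joins count, which is why the half length of `v` appears as the factor.
        refine sum_range_two_mul _ fun i => ?_
        have h3 := rotate_altWord b (n + 1) i
        have h4 := rotate_altWord b (n + 1) (i + 1)
        rw [show 2 * (i + 1) = 2 * i + 1 + 1 by ring] at h4
        rw [h3.2, h4.1]
        rcases signType_eq_or_eq_neg ha hb with rfl | rfl
        · rw [h1, h2, add_zero]
        · rw [neg_neg, h1, h2, zero_add]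
    · intro i hi
      rw [altFun₁_take_even ha k i hi, mul_zero, zero_add]
      have : altFun₂ ((-a :: altWord a k).take (2 * i + 1)) (altWord b (n + 1)) = 0 := by
        by_contra h
        exact not_isAlternating_take_even a k i hi (isAlternating_of_altFun₂_ne_zero h).1
      rw [this, mul_zero]
  · rw [cutSum₂, Finset.sum_eq_zero, Finset.sum_eq_zero, add_zero, add_zero]
    · by_contra h
      exact hw (isAlternating_of_altFun₂_ne_zero h)
    · intro k hk
      rw [Finset.mem_range] at hk
      by_contra h
      obtain ⟨h1, h2⟩ := isAlternating_of_join (by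
        rw [Ne, List.rotate_eq_nil_iff]; rintro rfl; simp at hk)
        (isAlternating_of_altFun₁_ne_zero ha h)
      exact hw ⟨h2, isAlternating_rotate_iff.1 h1⟩
    · intro k _
      have key : IsAlternating (a :: (-a :: l).drop (k + 1)) →
          IsAlternating ((-a :: l).take (k + 1)) → IsAlternating (a :: -a :: l) := by
        intro h1 h2
        rw [List.take_succ_cons] at h2
        have h3 := isAlternating_join h2 h1
        rwa [List.drop_succ_cons, List.take_append_drop] at h3
      have hmul : ∀ p q : ℤ, (p ≠ 0 → q ≠ 0 → False) → p * q = 0 := fun p q h => by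
        by_contra h'
        exact h (left_ne_zero_of_mul h') (right_ne_zero_of_mul h')
      rw [hmul, hmul, add_zero]
      · intro h1 h2
        have h3 := isAlternating_of_altFun₂_ne_zero h2
        exact hw ⟨key (isAlternating_of_altFun₁_ne_zero ha h1) h3.1, h3.2⟩
      · intro h1 h2
        have h3 := isAlternating_of_altFun₂_ne_zero h1
        rw [List.take_succ_cons] at h2
        have h4 := isAlternating_of_altFun₁_ne_zero (signType_neg_ne_zero ha) h2
        rw [← List.take_succ_cons] at h4
        exact hw ⟨key h3.1 h4, h3.2⟩

/-! ### Deleting a pair of opposite neighbouring letters -/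

section

variable {N : ℕ}

theorem altFun₁_eq_zero_of_mem {w : List SignType} (h0 : 0 ∈ w) (h : w ≠ [0]) : altFun₁ w = 0 := by
  rw [altFun₁, if_neg h, if_neg fun h => h.zero_notMem h0]

theorem altFun₂_eq_zero_of_mem {w : List SignType} (h0 : 0 ∈ w) (v : List SignType) :
    altFun₂ w v = 0 := if_neg fun h => h.1.zero_notMem h0

theorem mem_cycleWord_self {α : Type*} (a : Fin N → α) (π : Perm (Fin N)) (z : Fin N) :
    a z ∈ cycleWord a π z := by
  rw [cycleWord_eq_cons]; simp

theorem cycleWord_eq_singleton_iff {α : Type*} {a : Fin N → α} {π : Perm (Fin N)} {z : Fin N} :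
    cycleWord a π z = [a z] ↔ π z = z := by
  constructor
  · intro h
    exact apply_eq_of_tail_eq_nil a (by rw [h]; rfl)
  · intro h
    have : IsCycleList π [z] := ⟨by simp, by simp, by simp [h]⟩
    rw [cycleWord_eq_map, this.cycleList_eq]
    rfl

theorem altFun₁_cycleWord_eq_zero {a : Fin N → SignType} {π : Perm (Fin N)} {z : Fin N}
    (hz : a z = 0) (hπ : π z ≠ z) : altFun₁ (cycleWord a π z) = 0 := by
  refine altFun₁_eq_zero_of_mem (hz ▸ mem_cycleWord_self a π z) fun h => hπ ?_
  rw [← hz] at h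
  exact cycleWord_eq_singleton_iff.1 h

theorem multExt_altFun₁_eq_zero {a : Fin N → SignType} {π : Perm (Fin N)} {z : Fin N}
    (hz : a z = 0) (hπ : π z ≠ z) : multExt altFun₁ a π = 0 := by
  rw [multExt_eq_prod isCyclic_altFun₁ a (isTransversal_otherLeaders π z),
    Finset.prod_insert (notMem_otherLeaders π z), altFun₁_cycleWord_eq_zero hz hπ, zero_mul]

theorem weight₁_altFun₁_eq_zero {a : Fin N → SignType} {γ π : Perm (Fin N)} {z : Fin N}
    (hz : a z = 0) (hπ : π z ≠ z) : weight₁ altFun₁ a γ π = 0 := by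
  rw [weight₁, multExt_altFun₁_eq_zero hz hπ, ite_self]

/-- The letter 0 plays the part of the unit: of the words containing it, only `[0]` has a nonzero
value, and only in first order. -/
theorem weight₂_altFun₂_eq_zero {s : Fin N → Bool} {a : Fin N → SignType} {γ π : Perm (Fin N)}
    {z : Fin N} (hs : s z = true) (hz : a z = 0) (hπ : π z ≠ z) :
    weight₂ s altFun₁ altFun₂ a γ π = 0 := by
  rw [weight₂, multExt_altFun₁_eq_zero hz hπ, ite_self]
  split_ifs with h1 h2 <;> try rfl
  rw [pairExt_eq_pairSum isCyclic_altFun₁ isCyclic_altFun₂_left isCyclic_altFun₂_right a h1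
    (isTransversal_otherLeaders π z), pairSum_insert (notMem_otherLeaders π z) hs,
    altFun₁_cycleWord_eq_zero hz hπ, zero_mul, add_zero]
  refine Finset.sum_eq_zero fun j _ => ?_
  rw [altFun₂_eq_zero_of_mem (hz ▸ mem_cycleWord_self a π z), zero_mul]

theorem sameCycle_of_apply_eq {π : Perm (Fin N)} {x y : Fin N} (h : π x = y) : π.SameCycle x y :=
  ⟨1, by simpa using h⟩

theorem exists_cycleWord_eq {α : Type*} (a : Fin N → α) {π : Perm (Fin N)} {x y : Fin N}
    (hxy : π x = y) (hne : y ≠ x) :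
    ∃ l, cycleWord a π x = a x :: a y :: l ∧ (l = [] ↔ π y = x) := by
  obtain ⟨l, hl⟩ := exists_cycleList_eq_cons π x
  have h := isCycleList_cycleList π x
  rw [hl] at h
  cases l with
  | nil =>
    have := h.2.2
    simp only [List.map_cons, List.map_nil, List.rotate_singleton, List.cons.injEq, and_true] at this
    exact absurd (hxy ▸ this) hne
  | cons z l =>
    have h1 := (isCycleList_cons_iff.1 h).2
    simp only [List.map_cons, List.cons_append, List.cons.injEq] at h1
    obtain rfl : z = y := by rw [← hxy, h1.1]
    refine ⟨l.map a, by rw [cycleWord_eq_map, hl]; rfl, ?_⟩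
    rw [List.map_eq_nil_iff]
    constructor
    · rintro rfl
      simpa using h1.2
    · intro hy
      have h2 : IsCycleList π [x, z] := ⟨by simp, by simp [hne.symm], by simp [hxy, hy]⟩
      have := h2.cycleList_eq
      rw [hl] at this
      simpa using this

/-! ### Removing two neighbours from the rotation -/

/-- The rotation without the neighbours `x` and `γ x`. -/
def bypass (γ : Perm (Fin N)) (x : Fin N) : Perm (Fin N) :=
  γ * swap (γ⁻¹ x) (γ x) * swap (γ x) x

/-- The letters `x` and `y` are replaced by `0`. -/
def kill (a : Fin N → SignType) (x y : Fin N) (z : Fin N) : SignType :=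
  if z = x ∨ z = y then 0 else a z

variable {γ : Perm (Fin N)} {x : Fin N}

theorem bypass_self : bypass γ x x = x := by
  simp [bypass]

theorem inv_apply_ne_self (hx : γ x ≠ x) : γ⁻¹ x ≠ x := by
  rw [Ne, Perm.inv_eq_iff_eq]; exact hx.symm

theorem bypass_apply (hx : γ x ≠ x) : bypass γ x (γ x) = γ x := by
  rw [bypass, Perm.mul_apply, Perm.mul_apply, swap_apply_left,
    swap_apply_of_ne_of_ne (inv_apply_ne_self hx).symm hx.symm]

theorem bypass_of_ne {z : Fin N} (h1 : z ≠ x) (h2 : z ≠ γ x) (h3 : γ z ≠ x) :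
    bypass γ x z = γ z := by
  rw [bypass, Perm.mul_apply, Perm.mul_apply, swap_apply_of_ne_of_ne h2 h1,
    swap_apply_of_ne_of_ne _ h2]
  rintro rfl
  simp at h3

theorem bypass_inv_apply (hx : γ x ≠ x) (h : γ⁻¹ x ≠ γ x) : bypass γ x (γ⁻¹ x) = γ (γ x) := by
  rw [bypass, Perm.mul_apply, Perm.mul_apply,
    swap_apply_of_ne_of_ne h (inv_apply_ne_self hx), swap_apply_left]

/-- The defect does not change when a 2-cycle of neighbours is removed from `π` and from `γ`. In
general `π` and the complement each lose one and `γ` loses two. If `(x, γ x)` is a whole cycle of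
`γ`, the complement is unchanged and `γ` loses one. -/
theorem permLength_bypass_add {π : Perm (Fin N)} (hx : γ x ≠ x) (h1 : π x = γ x)
    (h2 : π (γ x) = x) :
    permLength (π * swap (γ x) x) +
      permLength ((π * swap (γ x) x)⁻¹ * bypass γ x) + permLength γ =
    permLength π + permLength (π⁻¹ * γ) + permLength (bypass γ x) := by
  have e1 := permLength_mul_swap_of_sameCycle (sameCycle_of_apply_eq h1) hx
  have i1 : π⁻¹ (γ x) = x := by rw [← h1]; simp
  have i2 : π⁻¹ x = γ x := by conv_lhs => rw [← h2]; simp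
  have e2 : (π * swap (γ x) x)⁻¹ * bypass γ x = π⁻¹ * γ * swap (γ⁻¹ x) (γ x) := by
    have h3 : π * swap (γ x) x = swap (γ x) x * π := by
      rw [Equiv.swap_mul_eq_mul_swap, i1, i2, swap_comm]
    have h4 : bypass γ x = swap (γ x) x * (γ * swap (γ⁻¹ x) (γ x)) := by
      rw [Equiv.swap_mul_eq_mul_swap, bypass, swap_comm (γ x) x]
      congr 2
      · rw [eq_comm, Perm.inv_eq_iff_eq, Perm.mul_apply,
          swap_apply_of_ne_of_ne (inv_apply_ne_self hx).symm hx.symm]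
      · rw [eq_comm, Perm.inv_eq_iff_eq, Perm.mul_apply, swap_apply_right]
        simp
    rw [h3, h4, mul_inv_rev, swap_inv, mul_assoc, ← mul_assoc (swap _ _) (swap _ _),
      swap_mul_self, one_mul, mul_assoc]
  have e3 : permLength (bypass γ x) + 1 = permLength (γ * swap (γ⁻¹ x) (γ x)) := by
    refine permLength_mul_swap_of_sameCycle (Perm.SameCycle.symm (sameCycle_of_apply_eq ?_)) hx
    simp
  rw [e2]
  rcases eq_or_ne (γ⁻¹ x) (γ x) with h | h
  · rw [h, mul_swap_self'] at e3
    rw [h, mul_swap_self']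
    omega
  · have e4 := permLength_mul_swap_of_sameCycle (π := γ) (i := γ⁻¹ x) (x := γ x)
      ⟨-2, by simp [zpow_neg, zpow_ofNat, pow_two]⟩ h
    have e5 := permLength_mul_swap_of_sameCycle (π := π⁻¹ * γ) (i := γ⁻¹ x) (x := γ x)
      (Perm.SameCycle.symm (sameCycle_of_apply_eq (by rw [Perm.mul_apply, ← i2]; simp))) h
    omega

variable {a : Fin N → SignType}

/-- The opposite letters make `cutSum₁` the indicator of `(x, γ x)` being a cycle of `π`. Splitting
this cycle is a bijection onto the permutations that fix both points, where `W` is supported. -/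
theorem sum_perm_bypass (hax : a x ≠ 0) (hay : a (γ x) = -a x) (r W : Perm (Fin N) → ℤ)
    (hW : ∀ π, π x ≠ x ∨ π (γ x) ≠ γ x → W π = 0)
    (hrW : ∀ π : Perm (Fin N), π x = γ x → π (γ x) = x → r π = W (π * swap (γ x) x)) :
    ∑ π with π x = γ x, cutSum₁ altFun₁ (a x) (cycleWord a π x).tail * r π = ∑ π, W π := by
  have hx : γ x ≠ x := fun h => signType_ne_neg_self hax (by rw [← hay, h])
  have h1 : ∀ π : Perm (Fin N), π x = γ x →
      cutSum₁ altFun₁ (a x) (cycleWord a π x).tail = if π (γ x) = x then 1 else 0 := by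
    intro π hπ
    obtain ⟨l, hl, hl'⟩ := exists_cycleWord_eq a hπ hx
    rw [hl, List.tail_cons, hay, cutSum₁_altFun₁ hax]
    simp only [hl']
  rw [Finset.sum_congr rfl fun π hπ => by
    rw [h1 π (Finset.mem_filter.1 hπ).2, ite_mul, one_mul, zero_mul], ← Finset.sum_filter,
    Finset.filter_filter]
  rw [← Finset.sum_filter_of_ne (s := univ) (f := W) (p := fun π => π x = x ∧ π (γ x) = γ x)]
  · refine Finset.sum_bij' (fun π _ => π * swap (γ x) x) (fun π _ => π * swap (γ x) x)
      ?_ ?_ ?_ ?_ ?_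
    · intro π hπ
      simpa [and_comm] using hπ
    · intro π hπ
      simpa [and_comm] using hπ
    · intro π _
      simp [mul_assoc]
    · intro π _
      simp [mul_assoc]
    · intro π hπ
      obtain ⟨-, h2, h3⟩ := Finset.mem_filter.1 hπ
      exact hrW π h2 h3
  · intro π _ h
    by_contra h'
    exact h (hW π (by tauto))

theorem kill_left {y : Fin N} : kill a x y x = 0 := if_pos (Or.inl rfl)

theorem kill_right {y : Fin N} : kill a x y y = 0 := if_pos (Or.inr rfl)

theorem altFun₁_singleton_zero : altFun₁ [0] = 1 := if_pos rfl

theorem altFun₁_cycleWord_eq_one {π : Perm (Fin N)} {z : Fin N} (hz : a z = 0) (hπ : π z = z) :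
    altFun₁ (cycleWord a π z) = 1 := by
  rw [cycleWord_eq_singleton_iff.2 hπ, hz, altFun₁_singleton_zero]

theorem cycleWord_kill {π : Perm (Fin N)} {y t : Fin N} (hxy : π.SameCycle x y)
    (ht : ¬ π.SameCycle x t) : cycleWord (kill a x y) (π * swap y x) t = cycleWord a π t := by
  rw [cycleWord_eq_map, cycleWord_eq_map, cycleList_mul_swap (fun h => ht h.symm)
    fun h => ht (hxy.trans h.symm)]
  refine List.map_congr_left fun z hz => if_neg ?_
  rw [mem_cycleList] at hz
  rintro (rfl | rfl)
  · exact ht hz.symm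
  · exact ht (hxy.trans hz.symm)

theorem sum_weight₁_kill (hax : a x ≠ 0) (hay : a (γ x) = -a x) :
    ∑ π, weight₁ altFun₁ a γ π = ∑ π, weight₁ altFun₁ (kill a x (γ x)) (bypass γ x) π := by
  have hx : γ x ≠ x := fun h => signType_ne_neg_self hax (by rw [← hay, h])
  rw [sum_weight₁ isCyclic_altFun₁ a γ x, ← sum_perm_bypass hax hay (fun π =>
    if permLength π + permLength (π⁻¹ * γ) = permLength γ then
      ∏ t ∈ otherLeaders π x, altFun₁ (cycleWord a π t) else 0)]
  · simp only [mul_ite, mul_zero]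
  · rintro π (h | h)
    · exact weight₁_altFun₁_eq_zero kill_left h
    · exact weight₁_altFun₁_eq_zero kill_right h
  · intro π h1 h2
    have hl := permLength_bypass_add hx h1 h2
    have hT := isTransversal_otherLeaders π x
    have hnx := notMem_otherLeaders π x
    have hsc := sameCycle_of_apply_eq h1
    rw [weight₁, multExt_eq_prod isCyclic_altFun₁ _ (hT.cut hnx hsc hx),
      Finset.prod_insert fun h => (Finset.mem_insert.1 h).elim (fun h => hx h.symm) hnx,
      Finset.prod_insert (hT.notMem_of_sameCycle hnx hsc),
      altFun₁_cycleWord_eq_one kill_left (by simp [h2]),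
      altFun₁_cycleWord_eq_one kill_right (by simp [h1]), one_mul, one_mul]
    refine if_congr (by omega) (Finset.prod_congr rfl fun t ht => ?_) rfl
    rw [cycleWord_kill hsc (not_sameCycle_of_mem_otherLeaders ht)]

/-- The two new fixed points carry the letter 0: each has first order factor 1 and can belong to no
joined pair, so the remaining cycles give the same terms. -/
theorem sum_weight₂_kill {s : Fin N → Bool} (hγ : ∀ z, s (γ z) = s z) (hsx : s x = true)
    (hax : a x ≠ 0) (hay : a (γ x) = -a x) :
    ∑ π, weight₂ s altFun₁ altFun₂ a γ π =
      ∑ π, weight₂ s altFun₁ altFun₂ (kill a x (γ x)) (bypass γ x) π := by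
  classical
  have hx : γ x ≠ x := fun h => signType_ne_neg_self hax (by rw [← hay, h])
  have hsy : s (γ x) = s x := hγ x
  rw [sum_weight₂ isCyclic_altFun₁ isCyclic_altFun₂_left isCyclic_altFun₂_right a hγ hsx]
  · apply sum_perm_bypass hax hay
    · rintro π (h | h)
      · exact weight₂_altFun₂_eq_zero hsx kill_left h
      · exact weight₂_altFun₂_eq_zero (hsy.trans hsx) kill_right h
    · intro π h1 h2
      have hl := permLength_bypass_add hx h1 h2
      have hT := isTransversal_otherLeaders π x
      have hnx := notMem_otherLeaders π x
      have hsc := sameCycle_of_apply_eq h1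
      have hny := hT.notMem_of_sameCycle hnx hsc
      have hnx' : x ∉ insert (γ x) (otherLeaders π x) := fun h =>
        (Finset.mem_insert.1 h).elim (fun h => hx h.symm) hnx
      have hword := fun t ht => cycleWord_kill (a := a) hsc
        (not_sameCycle_of_mem_otherLeaders (π := π) (z := t) ht)
      rw [weight₂]
      refine if_ctx_congr (mul_swap_side hsy).symm (fun hs => if_ctx_congr (by omega) (fun _ => ?_) fun _ => rfl)
        (fun _ => if_ctx_congr (by omega) (fun _ => ?_) fun _ => rfl)
      · rw [pairExt_eq_pairSum isCyclic_altFun₁ isCyclic_altFun₂_left isCyclic_altFun₂_right _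
          hs (hT.cut hnx hsc hx), pairSum_insert hnx' hsx,
          pairSum_insert hny (hsy.trans hsx), altFun₁_cycleWord_eq_one kill_left (by simp [h2]),
          altFun₁_cycleWord_eq_one kill_right (by simp [h1]), one_mul, one_mul,
          Finset.sum_eq_zero, Finset.sum_eq_zero, zero_add, zero_add]
        · refine pairSum_congr (fun i hi => ?_) fun i hi j hj => ?_
          · rw [hword i hi]
          · rw [hword i hi, hword j hj]
        · intro j _
          rw [altFun₂_eq_zero_of_mem, zero_mul]
          have := mem_cycleWord_self (kill a x (γ x)) (π * swap (γ x) x) (γ x)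
          rwa [kill_right] at this
        · intro j _
          rw [altFun₂_eq_zero_of_mem, zero_mul]
          have := mem_cycleWord_self (kill a x (γ x)) (π * swap (γ x) x) x
          rwa [kill_left] at this
      · rw [multExt_eq_prod isCyclic_altFun₁ _ (hT.cut hnx hsc hx), Finset.prod_insert hnx',
          Finset.prod_insert hny, altFun₁_cycleWord_eq_one kill_left (by simp [h2]),
          altFun₁_cycleWord_eq_one kill_right (by simp [h1]), one_mul, one_mul]
        exact Finset.prod_congr rfl fun t ht => by rw [hword t ht]
  · intro π hπ j
    obtain ⟨l, hl, -⟩ := exists_cycleWord_eq a hπ hx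
    rw [hl, List.tail_cons, hay]
    exact cutSum₂_altFun₂ hax _ _

/-! ### Height functions and the induction on the number of nonzero letters -/

/-- The letters `a` on the circles with `s = true` are the increments of a height function `h`, and
`γ` fixes the points with letter `0`. -/
structure IsHeight (s : Fin N → Bool) (a : Fin N → SignType) (γ : Perm (Fin N)) (h : Fin N → ℤ) :
    Prop where
  side : ∀ z, s (γ z) = s z
  fixed : ∀ z, s z = true → a z = 0 → γ z = z
  step : ∀ z, s z = true → h (γ z) = h z + (a z : ℤ)

theorem IsHeight.kill {s : Fin N → Bool} {h : Fin N → ℤ} (H : IsHeight s a γ h) (hsx : s x = true)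
    (hax : a x ≠ 0) (hay : a (γ x) = -a x) :
    IsHeight s (kill a x (γ x)) (bypass γ x) h := by
  have hx : γ x ≠ x := fun h => signType_ne_neg_self hax (by rw [← hay, h])
  have hsy := H.side x
  have hsp : s (γ⁻¹ x) = s x := by
    have := H.side (γ⁻¹ x)
    simpa using this.symm
  constructor
  · rw [bypass, mul_swap_side hsy, mul_swap_side (hsp.trans hsy.symm)]
    exact H.side
  · intro z hz hk
    by_cases h1 : z = x
    · rw [h1, bypass_self]
    by_cases h2 : z = γ x
    · rw [h2, bypass_apply hx]
    rw [SecondOrderFree.kill, if_neg (by tauto)] at hk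
    have h3 := H.fixed z hz hk
    rw [bypass_of_ne h1 h2 (by rwa [h3]), h3]
  · intro z hz
    by_cases h1 : z = x
    · rw [h1, bypass_self, kill_left]; simp
    by_cases h2 : z = γ x
    · rw [h2, bypass_apply hx, kill_right]; simp
    rw [SecondOrderFree.kill, if_neg (by tauto)]
    -- The predecessor of `x` now jumps to `γ (γ x)`, which has the height of `x` because the two
    -- increments cancel.
    by_cases h3 : γ z = x
    · have h4 : z = γ⁻¹ x := by rw [eq_comm, Perm.inv_eq_iff_eq, h3]
      rw [← H.step z hz, h3]
      rw [h4] at h2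
      rw [h4, bypass_inv_apply hx h2, H.step _ (hsy.trans hsx), H.step _ hsx, hay]
      have : ((-a x : SignType) : ℤ) = -(a x : ℤ) := by cases a x <;> rfl
      rw [this]
      ring
    · rw [bypass_of_ne h1 h2 h3, H.step z hz]

/-- At a point of maximal height among those with nonzero letter, the step into it must be +1 and
the step out of it -1. -/
theorem IsHeight.exists_opposite {s : Fin N → Bool} {h : Fin N → ℤ} (H : IsHeight s a γ h)
    (hne : ∃ z, s z = true ∧ a z ≠ 0) : ∃ x, s x = true ∧ a x ≠ 0 ∧ a (γ x) = -a x := by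
  obtain ⟨y, hy, hmax⟩ := Finset.exists_max_image (univ.filter fun z => s z = true ∧ a z ≠ 0) h
    (by obtain ⟨z, hz⟩ := hne; exact ⟨z, by simpa using hz⟩)
  simp only [mem_filter, mem_univ, true_and] at hy hmax
  obtain ⟨x, rfl⟩ := γ.surjective y
  have hsx : s x = true := by rw [← H.side, hy.1]
  have hax : a x ≠ 0 := by
    intro h0
    rw [H.fixed x hsx h0] at hy
    exact hy.2 h0
  have hyy : a (γ (γ x)) ≠ 0 := by
    intro h0
    have := H.fixed _ (by rw [H.side, hy.1]) h0
    rw [γ.injective this] at h0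
    exact hy.2 h0
  have h1 := hmax _ ⟨by rw [H.side, hy.1], hyy⟩
  have h2 := hmax _ ⟨hsx, hax⟩
  rw [H.step _ hy.1] at h1
  rw [H.step _ hsx] at h2
  refine ⟨x, hsx, hax, ?_⟩
  have h3 := hy.2
  revert h1 h2 hax h3
  generalize a x = b
  generalize a (γ x) = c
  cases b <;> cases c <;> simp

theorem card_kill_lt {s : Fin N → Bool} (y : Fin N) (hsx : s x = true) (hax : a x ≠ 0) :
    (univ.filter fun z => s z = true ∧ kill a x y z ≠ 0).card <
      (univ.filter fun z => s z = true ∧ a z ≠ 0).card := by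
  refine Finset.card_lt_card ⟨fun z hz => ?_, fun h => ?_⟩
  · simp only [mem_filter, mem_univ, true_and] at hz ⊢
    refine ⟨hz.1, fun h0 => hz.2 ?_⟩
    rw [kill, h0, ite_self]
  · have := h (show x ∈ univ.filter fun z => s z = true ∧ a z ≠ 0 by simp [hsx, hax])
    simp only [mem_filter, kill_left] at this
    exact this.2.2 rfl

theorem sum_weight₁_of_isHeight {h : Fin N → ℤ} (H : IsHeight (fun _ => true) a γ h) :
    ∑ π, weight₁ altFun₁ a γ π = 1 := by
  induction hk : (univ.filter fun z => (fun _ => true) z = true ∧ a z ≠ 0).card using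
    Nat.strong_induction_on generalizing a γ with
  | _ k ih =>
    by_cases hne : ∃ z, (fun _ : Fin N => true) z = true ∧ a z ≠ 0
    · obtain ⟨x, hsx, hax, hay⟩ := H.exists_opposite hne
      rw [sum_weight₁_kill hax hay]
      exact ih _ (hk ▸ card_kill_lt (γ x) hsx hax) (H.kill hsx hax hay) rfl
    · push Not at hne
      have ha : ∀ z, a z = 0 := fun z => hne z rfl
      have hγ : γ = 1 := Perm.ext fun z => H.fixed z rfl (ha z)
      rw [Finset.sum_eq_single 1, weight₁, if_pos (by simp [hγ, permLength_one]), multExt]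
      · exact Finset.prod_eq_one fun z _ => altFun₁_cycleWord_eq_one (ha z) rfl
      · intro π _ hπ
        obtain ⟨z, hz⟩ : ∃ z, π z ≠ z := by
          by_contra! h'
          exact hπ (Perm.ext h')
        exact weight₁_altFun₁_eq_zero (ha z) hz
      · simp

/-- Once all letters of the first circle are 0, every term vanishes: a joined pair and a connecting
cycle would each contain a 0, the latter in a word with other letters. -/
theorem sum_weight₂_of_isHeight {s : Fin N → Bool} {h : Fin N → ℤ} (H : IsHeight s a γ h) :
    ∑ π, weight₂ s altFun₁ altFun₂ a γ π = 0 := by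
  induction hk : (univ.filter fun z => s z = true ∧ a z ≠ 0).card using
    Nat.strong_induction_on generalizing a γ with
  | _ k ih =>
    by_cases hne : ∃ z, s z = true ∧ a z ≠ 0
    · obtain ⟨x, hsx, hax, hay⟩ := H.exists_opposite hne
      rw [sum_weight₂_kill H.side hsx hax hay]
      exact ih _ (hk ▸ card_kill_lt (γ x) hsx hax) (H.kill hsx hax hay) rfl
    · push Not at hne
      refine Finset.sum_eq_zero fun π _ => ?_
      rw [weight₂]
      split_ifs with h1 h2 h3 <;> try rfl
      · rw [pairExt, pairSum]
        refine Finset.sum_eq_zero fun i _ => Finset.sum_eq_zero fun j _ => ?_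
        split_ifs with h4
        · have := mem_cycleWord_self a π i
          rw [hne i h4.1] at this
          rw [altFun₂_eq_zero_of_mem this, zero_mul]
        · rfl
      · push Not at h1
        obtain ⟨z, hz⟩ := h1
        cases hs : s z with
        | true =>
          exact multExt_altFun₁_eq_zero (hne z hs) fun h => hz (by rw [h])
        | false =>
          refine multExt_altFun₁_eq_zero (hne (π z) (by simpa [hs] using hz)) fun h => hz ?_
          rw [π.injective h]

end

/-! ### Uniqueness of the inverse of the convolution -/

section

variable {α β R : Type*} [CommRing R]

/-- This replaces `Fin w.length` by `Fin n`. The length is a free variable in `key` so that it can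
be substituted. -/
theorem convZeta₁_ofFn {n : ℕ} (F : List α → R) (a : Fin n → α) :
    convZeta₁ F (List.ofFn a) = ∑ π ∈ NC n, multExt F a π := by
  have key : ∀ (w : List α) (n : ℕ) (hn : w.length = n) (a : Fin n → α),
      (∀ i, w.get i = a (Fin.cast hn i)) → convZeta₁ F w = ∑ π ∈ NC n, multExt F a π := by
    intro w n hn a ha
    subst hn
    obtain rfl : w.get = a := funext ha
    rfl
  exact key _ n (by simp) a fun i => by simp; rfl

theorem convZeta₂_ofFn {m n : ℕ} (F₁ : List α → R) (F₂ : List α → List α → R) (a : Fin m → α)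
    (b : Fin n → α) :
    convZeta₂ F₁ F₂ (List.ofFn a) (List.ofFn b) =
      (∑ π ∈ annularNC m n, multExt F₁ (Fin.append a b) π) +
      ∑ π₁ ∈ NC m, ∑ π₂ ∈ NC n, ∑ i ∈ leaders π₁, ∑ j ∈ leaders π₂,
        F₂ (cycleWord a π₁ i) (cycleWord b π₂ j) *
          (multExtErase F₁ a π₁ i * multExtErase F₁ b π₂ j) := by
  have key : ∀ (w v : List α) (m n : ℕ) (hm : w.length = m) (hn : v.length = n) (a : Fin m → α)
      (b : Fin n → α), (∀ i, w.get i = a (Fin.cast hm i)) → (∀ i, v.get i = b (Fin.cast hn i)) →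
      convZeta₂ F₁ F₂ w v = (∑ π ∈ annularNC m n, multExt F₁ (Fin.append a b) π) +
        ∑ π₁ ∈ NC m, ∑ π₂ ∈ NC n, ∑ i ∈ leaders π₁, ∑ j ∈ leaders π₂,
          F₂ (cycleWord a π₁ i) (cycleWord b π₂ j) *
            (multExtErase F₁ a π₁ i * multExtErase F₁ b π₂ j) := by
    intro w v m n hm hn a b ha hb
    subst hm hn
    obtain rfl : w.get = a := funext ha
    obtain rfl : v.get = b := funext hb
    rfl
  exact key _ _ m n (by simp) (by simp) a b (fun i => by simp; rfl) fun i => by simp; rfl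

theorem multExt_finRotate (F : List α → R) {n : ℕ} (a : Fin n → α) (hn : n ≠ 0) :
    multExt F a (finRotate n) = F (List.ofFn a) := by
  obtain ⟨n, rfl⟩ := Nat.exists_eq_succ_of_ne_zero hn
  rw [multExt, leaders_of_full finRotate_full, Finset.prod_singleton, cycleWord_finRotate]

theorem length_cycleWord_lt {n : ℕ} (a : Fin n → α) {π : Perm (Fin n)} (hπ : π ∈ NC n)
    (hne : π ≠ finRotate n) (i : Fin n) : (cycleWord a π i).length < n := by
  obtain ⟨n, rfl⟩ := Nat.exists_eq_succ_of_ne_zero (n := n) (by rintro rfl; exact i.elim0)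
  by_contra h
  exact hne (eq_finRotate_of_full hπ (full_of_length a π i h))

theorem cycleWord_ne_nil {n : ℕ} (a : Fin n → α) (π : Perm (Fin n)) (i : Fin n) :
    cycleWord a π i ≠ [] := by
  rw [cycleWord_eq_cons]; simp

theorem cycleWord_comp {n : ℕ} (f : β → α) (a : Fin n → β) (π : Perm (Fin n)) (i : Fin n) :
    cycleWord (f ∘ a) π i = (cycleWord a π i).map f := by
  simp [cycleWord]

/-- By induction on the length all terms but that of `γ_n` agree on both sides, hence so does this
last one. The map `f` restricts attention to words over a small alphabet, such as signs standing for
`u` and `u*`. -/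
theorem unzeta₁_map_eq (f : β → α) {M : List α → R} {F : List β → R}
    (h : ∀ w ≠ [], convZeta₁ F w = M (w.map f)) (w : List β) (hw : w ≠ []) :
    unzeta₁ M (w.map f) = F w := by
  induction hn : w.length using Nat.strong_induction_on generalizing w with
  | _ n ih =>
    obtain ⟨a, rfl⟩ : ∃ a : Fin n → β, w = List.ofFn a := by
      subst hn; exact ⟨w.get, by simp⟩
    have hn0 : n ≠ 0 := by rintro rfl; simp at hw
    have h1 := convZeta₁_unzeta₁ M ((List.ofFn a).map f) (by simpa using hw)
    have h2 : ∀ π ∈ (NC n).erase (finRotate n),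
        multExt (unzeta₁ M) (f ∘ a) π = multExt F a π := fun π hπ =>
      Finset.prod_congr rfl fun i _ => by
        rw [cycleWord_comp, ih _ (length_cycleWord_lt a (Finset.mem_of_mem_erase hπ)
          (Finset.ne_of_mem_erase hπ) i) _ (cycleWord_ne_nil a π i) rfl]
    rw [← h _ hw, List.map_ofFn, convZeta₁_ofFn, convZeta₁_ofFn,
      ← Finset.add_sum_erase _ _ (finRotate_mem_NC n),
      ← Finset.add_sum_erase _ _ (finRotate_mem_NC n), multExt_finRotate _ _ hn0,
      multExt_finRotate _ _ hn0, Finset.sum_congr rfl h2] at h1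
    rw [List.map_ofFn]
    exact add_right_cancel h1

theorem append_comp {m n : ℕ} (f : β → α) (a : Fin m → β) (b : Fin n → β) :
    Fin.append (f ∘ a) (f ∘ b) = f ∘ Fin.append a b := by
  funext z
  induction z using Fin.addCases <;> simp

/-- `Q` confines the comparison to a class of words that the recursion does not leave: `hQ` concerns
only cycles whose cofactor is nonzero. -/
theorem unzeta₂_map_eq (f : β → α) {M₁ : List α → R} {M₂ : List α → List α → R} {F₁ : List β → R}
    {F₂ : List β → List β → R} (hF₁ : ∀ w ≠ [], unzeta₁ M₁ (w.map f) = F₁ w) {Q : List β → Prop}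
    (hQ : ∀ {n : ℕ} (a : Fin n → β) (π : Perm (Fin n)), ∀ i ∈ leaders π, Q (List.ofFn a) →
      multExtErase F₁ a π i ≠ 0 → Q (cycleWord a π i))
    (h : ∀ w ≠ [], ∀ v ≠ [], Q w → Q v → convZeta₂ F₁ F₂ w v = M₂ (w.map f) (v.map f))
    (w : List β) (hw : w ≠ []) (v : List β) (hv : v ≠ []) (hQw : Q w) (hQv : Q v) :
    unzeta₂ M₁ M₂ (w.map f) (v.map f) = F₂ w v := by
  induction hk : w.length + v.length using Nat.strong_induction_on generalizing w v with
  | _ k ih =>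
    obtain ⟨m, a, rfl⟩ : ∃ m, ∃ a : Fin m → β, w = List.ofFn a := ⟨_, w.get, by simp⟩
    obtain ⟨n, b, rfl⟩ : ∃ n, ∃ b : Fin n → β, v = List.ofFn b := ⟨_, v.get, by simp⟩
    have hm0 : m ≠ 0 := by rintro rfl; simp at hw
    have hn0 : n ≠ 0 := by rintro rfl; simp at hv
    simp only [List.length_ofFn] at hk
    have h1 := convZeta₂_unzeta₂ M₁ M₂ ((List.ofFn a).map f) ((List.ofFn b).map f)
      (by simpa using hw) (by simpa using hv)
    have hmult : ∀ {N : ℕ} (c : Fin N → β) (π : Perm (Fin N)) (i : Fin N),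
        multExt (unzeta₁ M₁) (f ∘ c) π = multExt F₁ c π ∧
        multExtErase (unzeta₁ M₁) (f ∘ c) π i = multExtErase F₁ c π i := by
      intro N c π i
      constructor <;> refine Finset.prod_congr rfl fun j _ => ?_ <;>
        rw [cycleWord_comp, hF₁ _ (cycleWord_ne_nil c π j)]
    have hmult₁ : ∀ π : Perm (Fin (m + n)), multExt (unzeta₁ M₁) (f ∘ Fin.append a b) π =
        multExt F₁ (Fin.append a b) π := fun π =>
      (hmult _ π (Fin.castAdd n ⟨0, Nat.pos_of_ne_zero hm0⟩)).1
    rw [← h _ hw _ hv hQw hQv, List.map_ofFn, List.map_ofFn, convZeta₂_ofFn, convZeta₂_ofFn,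
      append_comp, Finset.sum_congr rfl fun π _ => hmult₁ π] at h1
    replace h1 := add_left_cancel h1
    simp only [cycleWord_comp, (hmult _ _ _).2] at h1
    rw [← sub_eq_zero] at h1 ⊢
    simp only [← Finset.sum_sub_distrib, ← sub_mul] at h1
    -- Here the joined words are shorter in total. Either the cofactor is 0, or both words satisfy
    -- `Q` and the induction hypothesis applies.
    have small : ∀ π₁ ∈ NC m, ∀ π₂ ∈ NC n, (π₁ ≠ finRotate m ∨ π₂ ≠ finRotate n) →
        (∑ i ∈ leaders π₁, ∑ j ∈ leaders π₂,
          (unzeta₂ M₁ M₂ ((cycleWord a π₁ i).map f) ((cycleWord b π₂ j).map f) -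
            F₂ (cycleWord a π₁ i) (cycleWord b π₂ j)) *
          (multExtErase F₁ a π₁ i * multExtErase F₁ b π₂ j)) = 0 := by
      intro π₁ h₁ π₂ h₂ hne
      refine Finset.sum_eq_zero fun i hi => Finset.sum_eq_zero fun j hj => ?_
      by_contra h0
      have h3 := right_ne_zero_of_mul h0
      refine left_ne_zero_of_mul h0 (sub_eq_zero.2 (ih _ ?_ _ (cycleWord_ne_nil a π₁ i) _
        (cycleWord_ne_nil b π₂ j) (hQ a π₁ i hi hQw (left_ne_zero_of_mul h3))
        (hQ b π₂ j hj hQv (right_ne_zero_of_mul h3)) rfl))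
      have h4 := length_cycleWord_le a π₁ i
      have h5 := length_cycleWord_le b π₂ j
      rcases hne with hne | hne
      · have := length_cycleWord_lt a h₁ hne i
        omega
      · have := length_cycleWord_lt b h₂ hne j
        omega
    rw [Finset.sum_eq_single_of_mem _ (finRotate_mem_NC m) fun π₁ h₁ hne =>
        Finset.sum_eq_zero fun π₂ h₂ => small π₁ h₁ π₂ h₂ (Or.inl hne),
      Finset.sum_eq_single_of_mem _ (finRotate_mem_NC n) fun π₂ h₂ hne =>
        small _ (finRotate_mem_NC m) π₂ h₂ (Or.inr hne)] at h1
    obtain ⟨m, rfl⟩ := Nat.exists_eq_succ_of_ne_zero hm0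
    obtain ⟨n, rfl⟩ := Nat.exists_eq_succ_of_ne_zero hn0
    rw [leaders_of_full finRotate_full, leaders_of_full finRotate_full, Finset.sum_singleton,
      Finset.sum_singleton, cycleWord_finRotate, cycleWord_finRotate] at h1
    simpa [multExtErase, leaders_of_full finRotate_full] using h1

end

/-! ### The values of the Möbius function -/

theorem convZeta₁_signedCatalan (w : List Unit) (hw : w ≠ []) :
    convZeta₁ (fun w => signedCatalan w.length) w = delta₁ w := by
  obtain ⟨n, a, rfl⟩ : ∃ n, ∃ a : Fin n → Unit, w = List.ofFn a := ⟨_, w.get, by simp⟩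
  rw [convZeta₁_ofFn, delta₁, List.length_ofFn]
  match n with
  | 0 => simp at hw
  | 1 =>
    have : NC 1 = {finRotate 1} := Finset.eq_singleton_iff_unique_mem.2
      ⟨finRotate_mem_NC 1, fun _ _ => Subsingleton.elim _ _⟩
    rw [this, Finset.sum_singleton, multExt_finRotate _ _ one_ne_zero]
    simp [signedCatalan]
  | n + 2 =>
    rw [sum_NC_eq, sum_weight₁_signedCatalan a (x := 0), if_neg (by omega)]
    rw [finRotate_apply]
    simp

theorem convZeta₂_signedAnnular (w : List Unit) (hw : w ≠ []) (v : List Unit) :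
    convZeta₂ (fun w => signedCatalan w.length)
      (fun w v => signedAnnular w.length v.length) w v = 0 := by
  obtain ⟨m, a, rfl⟩ : ∃ m, ∃ a : Fin m → Unit, w = List.ofFn a := ⟨_, w.get, by simp⟩
  obtain ⟨n, b, rfl⟩ : ∃ n, ∃ b : Fin n → Unit, v = List.ofFn b := ⟨_, v.get, by simp⟩
  have hm0 : m ≠ 0 := by rintro rfl; simp at hw
  obtain ⟨m, rfl⟩ := Nat.exists_eq_succ_of_ne_zero hm0
  rw [convZeta₂_ofFn]
  refine (sum_annular_eq (fun w => signedCatalan w.length)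
    (fun w v => signedAnnular w.length v.length) a b).trans
      (sum_weight₂_signedAnnular _ _ side_annularRotate (x := Fin.castAdd n 0) (side_castAdd 0) ?_)
  intro h z hz
  rw [annularRotate_eq_glue, glue_castAdd] at h
  have h1 : finRotate (m + 1) 0 = 0 := by simpa using h
  have hm : m = 0 := by
    by_contra hm
    obtain ⟨k, rfl⟩ := Nat.exists_eq_succ_of_ne_zero hm
    rw [finRotate_apply] at h1
    simp at h1
  subst hm
  induction z using Fin.addCases with
  | left i => exact congrArg (Fin.castAdd n) (Fin.ext (by simp))
  | right j => simp at hz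

theorem moebius₂_eq_signedAnnular {m n : ℕ} (hm : m ≠ 0) (hn : n ≠ 0) :
    moebius₂ m n = signedAnnular m n := by
  have h := unzeta₂_map_eq (id : Unit → Unit) (M₁ := delta₁) (M₂ := fun _ _ => (0 : ℤ))
    (F₁ := fun w => signedCatalan w.length) (F₂ := fun w v => signedAnnular w.length v.length)
    (Q := fun _ => True)
    (unzeta₁_map_eq id fun w hw => by rw [convZeta₁_signedCatalan w hw, List.map_id])
    (fun _ _ _ _ _ _ => trivial) (fun w hw v _ _ _ => convZeta₂_signedAnnular w hw v)
    (List.replicate m ()) (by simpa using hm) (List.replicate n ()) (by simpa using hn)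
    trivial trivial
  rw [List.map_id, List.map_id] at h
  rw [moebius₂, h]
  simp

/-! ### The cumulants of a Haar unitary -/

/-- A sign as an element of `SignType`. -/
def unitSign (e : ℤˣ) : SignType := if e = 1 then 1 else -1

theorem coe_unitSign (e : ℤˣ) : ((unitSign e : SignType) : ℤ) = e := by
  rcases Int.units_eq_one_or e with rfl | rfl <;> rfl

theorem unitSign_neg (e : ℤˣ) : unitSign (-e) = -unitSign e := by
  rcases Int.units_eq_one_or e with rfl | rfl <;> rfl

theorem unitSign_ne_zero (e : ℤˣ) : unitSign e ≠ 0 := by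
  rcases Int.units_eq_one_or e with rfl | rfl <;> decide

/-- The total exponent of a word in `u` and `u⁻¹`. -/
def exponent (w : List ℤˣ) : ℤ := (w.map fun e : ℤˣ => (e : ℤ)).sum

theorem IsAlternating.sum_eq_zero {w : List SignType} (h : IsAlternating w) :
    (w.map fun a : SignType => (a : ℤ)).sum = 0 := by
  obtain ⟨a, -, k, rfl⟩ := h
  generalize k + 1 = n
  induction n with
  | zero => rfl
  | succ n ih =>
    simp only [altWord, List.map_cons, List.sum_cons, ih]
    cases a <;> rfl

theorem exponent_eq_zero_of_isAlternating {w : List ℤˣ} (h : IsAlternating (w.map unitSign)) :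
    exponent w = 0 := by
  rw [← h.sum_eq_zero]
  simp [exponent, Function.comp_def, coe_unitSign]

theorem exponent_eq_zero_of_altFun₁_ne_zero {w : List ℤˣ}
    (h : altFun₁ (w.map unitSign) ≠ 0) : exponent w = 0 := by
  cases w with
  | nil => rfl
  | cons e w =>
    exact exponent_eq_zero_of_isAlternating
      (isAlternating_of_altFun₁_ne_zero (unitSign_ne_zero e) h)

theorem exponent_ofFn {n : ℕ} (e : Fin n → ℤˣ) (π : Perm (Fin n)) :
    exponent (List.ofFn e) = ∑ i ∈ leaders π, exponent (cycleWord e π i) := by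
  have h1 : exponent (List.ofFn e) = ∑ i, (e i : ℤ) := by
    rw [exponent, List.map_ofFn, List.sum_ofFn]; rfl
  rw [h1, sum_eq_sum_transversal (isTransversal_leaders π)]
  refine Finset.sum_congr rfl fun j _ => ?_
  have h2 : (univ.filter fun i => π.SameCycle j i) = (cycleList π j).toFinset := by
    ext z
    rw [List.mem_toFinset, mem_cycleList]
    simp
  rw [h2, List.sum_toFinset _ (isCycleList_cycleList π j).2.1, exponent, cycleWord_eq_map,
    List.map_map]
  rfl

/-- The height function of a word: its partial sums. -/
def partialSum {n : ℕ} (e : Fin n → ℤˣ) (z : Fin n) : ℤ := ∑ i ∈ Finset.Iio z, (e i : ℤ)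

/-- Exponent 0 is needed only at the last point, where the height has to return to 0. -/
theorem partialSum_finRotate {n : ℕ} {e : Fin n → ℤˣ} (he : exponent (List.ofFn e) = 0)
    (z : Fin n) : partialSum e (finRotate n z) = partialSum e z + e z := by
  obtain ⟨n, rfl⟩ := Nat.exists_eq_succ_of_ne_zero (n := n) (by rintro rfl; exact z.elim0)
  have h1 : partialSum e z + e z = ∑ i ∈ Finset.Iic z, (e i : ℤ) := by
    rw [partialSum, ← Finset.Iio_insert, Finset.sum_insert (by simp), add_comm]
  rw [h1]
  rcases Nat.lt_or_ge z n with h | h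
  · rw [partialSum]
    refine Finset.sum_congr ?_ fun _ _ => rfl
    ext i
    have : finRotate (n + 1) z = ⟨z + 1, by omega⟩ := finRotate_of_lt h
    rw [this]
    simp only [Finset.mem_Iio, Finset.mem_Iic, Fin.lt_def, Fin.le_def]
    omega
  · obtain rfl : z = Fin.last n := Fin.ext (by simp; omega)
    have h2 : (Finset.Iic (Fin.last n)) = univ := by ext i; simp [Fin.le_last]
    have h3 : exponent (List.ofFn e) = ∑ i, (e i : ℤ) := by
      rw [exponent, List.map_ofFn, List.sum_ofFn]; rfl
    rw [finRotate_last, h2, ← h3, he, partialSum]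
    refine Finset.sum_eq_zero fun i hi => ?_
    simp at hi

/-- If the exponent is not 0, every `π` has an unbalanced cycle, on which `altFun₁` vanishes.
Otherwise the partial sums are a height function. -/
theorem convZeta₁_altFun₁ (w : List ℤˣ) (hw : w ≠ []) :
    convZeta₁ (fun w => altFun₁ (w.map unitSign)) w = if exponent w = 0 then 1 else 0 := by
  obtain ⟨n, e, rfl⟩ : ∃ n, ∃ e : Fin n → ℤˣ, w = List.ofFn e := ⟨_, w.get, by simp⟩
  rw [convZeta₁_ofFn]
  split_ifs with h
  · have H : IsHeight (fun _ => true) (unitSign ∘ e) (finRotate n) (partialSum e) :=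
      ⟨fun _ => rfl, fun z _ h0 => absurd h0 (unitSign_ne_zero _), fun z _ => by
        rw [partialSum_finRotate h, Function.comp_apply, coe_unitSign]⟩
    rw [← sum_weight₁_of_isHeight H, ← sum_NC_eq]
    refine Finset.sum_congr rfl fun π _ => ?_
    simp only [multExt, cycleWord_comp]
  · refine Finset.sum_eq_zero fun π _ => ?_
    by_contra h0
    rw [multExt, Finset.prod_eq_zero_iff] at h0
    push Not at h0
    refine h ?_
    rw [exponent_ofFn e π]
    exact Finset.sum_eq_zero fun i hi => exponent_eq_zero_of_altFun₁_ne_zero (h0 i hi)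

theorem convZeta₂_altFun₂ (w v : List ℤˣ) (hw : exponent w = 0) :
    convZeta₂ (fun w => altFun₁ (w.map unitSign))
      (fun w v => altFun₂ (w.map unitSign) (v.map unitSign)) w v = 0 := by
  obtain ⟨m, a, rfl⟩ : ∃ m, ∃ a : Fin m → ℤˣ, w = List.ofFn a := ⟨_, w.get, by simp⟩
  obtain ⟨n, b, rfl⟩ : ∃ n, ∃ b : Fin n → ℤˣ, v = List.ofFn b := ⟨_, v.get, by simp⟩
  -- Only the first circle is reduced, so the height on the second is immaterial and is set to 0.
  have H : IsHeight (side m n) (Fin.append (unitSign ∘ a) (unitSign ∘ b)) (annularRotate m n)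
      (Fin.append (partialSum a) fun _ => 0) := by
    refine ⟨side_annularRotate, fun z _ h0 => ?_, fun z hz => ?_⟩
    · rw [append_comp] at h0
      exact absurd h0 (unitSign_ne_zero _)
    · rw [annularRotate_eq_glue]
      induction z using Fin.addCases with
      | left i =>
        rw [glue_castAdd, Fin.append_left, Fin.append_left, Fin.append_left,
          partialSum_finRotate hw, Function.comp_apply, coe_unitSign]
      | right j => simp at hz
  have h := sum_annular_eq altFun₁ altFun₂ (unitSign ∘ a) (unitSign ∘ b)
  rw [sum_weight₂_of_isHeight H] at h
  rw [convZeta₂_ofFn, ← h, append_comp]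
  simp only [multExt, multExtErase, cycleWord_comp]

/-- Exponents add up over the cycles, and all cycles in a nonzero cofactor are balanced. -/
theorem exponent_cycleWord_eq_zero {n : ℕ} (e : Fin n → ℤˣ) (π : Perm (Fin n)) (i : Fin n)
    (hi : i ∈ leaders π) (he : exponent (List.ofFn e) = 0)
    (h : multExtErase (fun w => (altFun₁ (w.map unitSign) : ℂ)) e π i ≠ 0) :
    exponent (cycleWord e π i) = 0 := by
  rw [exponent_ofFn e π, ← Finset.add_sum_erase _ _ hi, Finset.sum_eq_zero, add_zero] at he
  · exact he
  · intro j hj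
    rw [multExtErase, Finset.prod_ne_zero_iff] at h
    exact exponent_eq_zero_of_altFun₁_ne_zero (by exact_mod_cast h j hj)

section

variable {A : Type*} [Ring A] [StarRing A] {u : A}

theorem prod_map_starLetter (hu : u ∈ unitary A) (w : List ℤˣ) :
    (w.map (starLetter u)).prod = ((Unitary.toUnits ⟨u, hu⟩ ^ exponent w : Aˣ) : A) := by
  induction w with
  | nil => simp [exponent]
  | cons e w ih =>
    have h1 : starLetter u e = ((Unitary.toUnits ⟨u, hu⟩ ^ (e : ℤ) : Aˣ) : A) := by
      rcases Int.units_eq_one_or e with rfl | rfl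
      · simp [starLetter]
      · rw [starLetter, if_neg (by decide)]
        simp
        rfl
    rw [List.map_cons, List.prod_cons, ih, h1, ← Units.val_mul, ← zpow_add]
    rfl

end

namespace SecondOrderProbabilitySpace

variable {A : Type*} [Ring A] [Algebra ℂ A] [StarRing A] {P : SecondOrderProbabilitySpace A}
  {u : A}

theorem IsHaarUnitary.φ_prod (hu : P.IsHaarUnitary u) (w : List ℤˣ) :
    P.φ (w.map (starLetter u)).prod = if exponent w = 0 then 1 else 0 := by
  rw [prod_map_starLetter hu.mem_unitary]
  obtain ⟨k, hk | hk⟩ := (exponent w).eq_nat_or_neg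
  · rw [hk]
    rcases Nat.eq_zero_or_pos k with rfl | hpos
    · simp [P.φ_one]
    · rw [if_neg (by omega), zpow_natCast, Units.val_pow_eq_pow_val]
      exact hu.φ_pow k hpos
  · rw [hk]
    rcases Nat.eq_zero_or_pos k with rfl | hpos
    · simp [P.φ_one]
    · rw [if_neg (by omega), zpow_neg, ← inv_zpow, zpow_natCast, Units.val_pow_eq_pow_val]
      exact hu.φ_star_pow k hpos

theorem IsHaarUnitary.cumulant₁_eq (hu : P.IsHaarUnitary u) (w : List ℤˣ) (hw : w ≠ []) :
    P.cumulant₁ (w.map (starLetter u)) = altFun₁ (w.map unitSign) := by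
  refine unzeta₁_map_eq (starLetter u) (F := fun w => (altFun₁ (w.map unitSign) : ℂ))
    (fun w hw => ?_) w hw
  rw [hu.φ_prod]
  have := congrArg (Int.cast : ℤ → ℂ) (convZeta₁_altFun₁ w hw)
  simpa [convZeta₁, multExt] using this

/-- A word of exponent 0 multiplies to 1, where φ₂ vanishes, in accordance with `convZeta₂_altFun₂`.
-/
theorem IsHaarUnitary.cumulant₂_eq (hu : P.IsHaarUnitary u) {w v : List ℤˣ} (hw : w ≠ [])
    (hv : v ≠ []) (hw0 : exponent w = 0) (hv0 : exponent v = 0) :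
    P.cumulant₂ (w.map (starLetter u)) (v.map (starLetter u)) =
      altFun₂ (w.map unitSign) (v.map unitSign) := by
  refine unzeta₂_map_eq (starLetter u) (F₁ := fun w => (altFun₁ (w.map unitSign) : ℂ))
    (F₂ := fun w v => (altFun₂ (w.map unitSign) (v.map unitSign) : ℂ))
    (Q := fun w => exponent w = 0) hu.cumulant₁_eq
    (fun e π i hi he h => exponent_cycleWord_eq_zero e π i hi he h)
    (fun w _ v _ hw hv => ?_) w hw v hv hw0 hv0
  rw [prod_map_starLetter hu.mem_unitary, prod_map_starLetter hu.mem_unitary, hw, hv, zpow_zero,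
    Units.val_one, P.φ₂_one]
  have := congrArg (Int.cast : ℤ → ℂ) (convZeta₂_altFun₂ w v hw)
  simpa [convZeta₂, multExt, multExtErase] using this

end SecondOrderProbabilitySpace

theorem map_unitSign_eq_altWord {m : ℕ} (e : ℤˣ) {w : List ℤˣ} (hl : w.length = 2 * m)
    (h : ∀ (k : ℕ) (hk : k < w.length), w[k] = (-1) ^ k * e) :
    w.map unitSign = altWord (unitSign e) m := by
  induction m generalizing w with
  | zero => simpa [altWord] using hl
  | succ m ih =>
    match w, hl with
    | x :: y :: w, hl =>
      have hx := h 0 (by simp)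
      have hy := h 1 (by simp)
      simp only [List.getElem_cons_zero, List.getElem_cons_succ, pow_zero, pow_one, one_mul,
        neg_mul] at hx hy
      rw [List.map_cons, List.map_cons, altWord, hx, hy, unitSign_neg, ih]
      · simp only [List.length_cons] at hl
        omega
      · intro k hk
        have := h (k + 2) (by simpa using hk)
        rw [pow_add] at this
        simpa using this

theorem exists_map_unitSign_eq_altWord {m : ℕ} (hm : m ≠ 0) (e : Fin (2 * m) → ℤˣ)
    (he : ∀ i j : Fin (2 * m), (j : ℕ) = i + 1 → e j = -e i) :
    ∃ a ≠ 0, (List.ofFn e).map unitSign = altWord a m := by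
  refine ⟨_, unitSign_ne_zero (e ⟨0, by omega⟩), map_unitSign_eq_altWord _ (by simp) ?_⟩
  intro k hk
  rw [List.length_ofFn] at hk
  rw [List.getElem_ofFn]
  induction k with
  | zero => simp
  | succ k ih =>
    rw [he ⟨k, by omega⟩ ⟨k + 1, hk⟩ rfl, ih (by omega) (by simpa using by omega), pow_succ]
    simp

theorem exponent_eq_zero_of_map_eq_altWord {w : List ℤˣ} {a : SignType} {m : ℕ} (hm : m ≠ 0)
    (ha : a ≠ 0) (h : w.map unitSign = altWord a m) : exponent w = 0 :=
  exponent_eq_zero_of_isAlternating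
    ⟨a, ha, m - 1, by rw [h, Nat.sub_add_cancel (Nat.pos_of_ne_zero hm)]⟩

end SecondOrderFree

/-- The signs `ε_1, …, ε_{2m}` alternate and the signs `ε_{2m+1}, …, ε_{2m+2n}` alternate; nothing is
assumed about the pair `(ε_{2m}, ε_{2m+1})`. -/
theorem proposition8p3 {A : Type*} [Ring A] [Algebra ℂ A] [StarRing A] [StarModule ℂ A]
    (P : SecondOrderFree.SecondOrderProbabilitySpace A) (u : A) (hu : P.IsHaarUnitary u)
    (m n : ℕ) (hm : 1 ≤ m) (hn : 1 ≤ n) (ε : Fin (2 * m + 2 * n) → ℤˣ)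
    (hε : ∀ i j : Fin (2 * m + 2 * n), (j : ℕ) = (i : ℕ) + 1 → (j : ℕ) ≠ 2 * m → ε j = -ε i) :
    P.cumulant₂
        (List.ofFn fun i : Fin (2 * m) => SecondOrderFree.starLetter u (ε (Fin.castAdd (2 * n) i)))
        (List.ofFn fun j : Fin (2 * n) => SecondOrderFree.starLetter u (ε (Fin.natAdd (2 * m) j)))
      = (-1) ^ (m + n) * (SecondOrderFree.annularCatalan m n : ℂ) ∧
    SecondOrderFree.moebius₂ m n = (-1) ^ (m + n) * SecondOrderFree.annularCatalan m n := by
  open SecondOrderFree in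
  have hm0 : m ≠ 0 := by omega
  have hn0 : n ≠ 0 := by omega
  -- The sign of μ_{m,n} is explicit because `annularNumber` takes values in `ℕ`.
  have hμ : moebius₂ m n = (-1) ^ (m + n) * annularCatalan m n := by
    rw [annularCatalan, moebius₂_eq_signedAnnular hm0 hn0, signedAnnular, abs_mul, abs_pow, abs_neg,
      abs_one, one_pow, one_mul, Nat.abs_cast]
  refine ⟨?_, hμ⟩
  obtain ⟨a, ha, hwa⟩ := exists_map_unitSign_eq_altWord hm0 (fun i => ε (Fin.castAdd (2 * n) i))
    fun i j hij => hε _ _ (by simpa using hij) (by have := j.isLt; simp; omega)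
  obtain ⟨b, hb, hvb⟩ := exists_map_unitSign_eq_altWord hn0 (fun j => ε (Fin.natAdd (2 * m) j))
    fun i j hij => hε _ _ (by simp; omega) (by simp; omega)
  have h := hu.cumulant₂_eq (w := List.ofFn fun i => ε (Fin.castAdd (2 * n) i))
    (v := List.ofFn fun j => ε (Fin.natAdd (2 * m) j))
    (by rw [Ne, List.ofFn_eq_nil_iff]; omega) (by rw [Ne, List.ofFn_eq_nil_iff]; omega)
    (exponent_eq_zero_of_map_eq_altWord hm0 ha hwa) (exponent_eq_zero_of_map_eq_altWord hn0 hb hvb)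
  rw [List.map_ofFn, List.map_ofFn, hwa, hvb, altFun₂_altWord ha hb hm0 hn0,
    ← moebius₂_eq_signedAnnular hm0 hn0, hμ] at h
  push_cast at h
  exact h
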